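/- **Setting.** Fix countably many relation symbols of every arity $\ge 1$ and countably many constants; FO-formulas are built from atoms over variables and constants (with equality). Concept names and role names are the unary and the binary relation symbols; a role is a role name $r$ or its inverse $r^-$. *$\mathcal{ALCFIO}$* has the concepts $$C,D ::= A \mid \{o\} \mid \neg C \mid C\sqcap D \mid \exists R.C$$ ($A$ a concept name, $o$ a constant, $R$ a role), read as FO-formulas with one free variable via the standard translation (with $\{o\}$ read as $x=o$), and its ontologies are finite sets of concept inclusions $C\sqsubseteq D$, i.e. $\forall x(C(x)\to D(x))$, and functionality assertions $\top\sqsubseteq(\leqslant 1\,R)$, i.e. $\forall x\forall y\forall z(R(x,y)\wedge R(x,z)\to y=z)$. Databases of $\mathcal{ALCFIO}$ use unary and binary relation symbols only, and examples are single constants. A *logic* $L$ is a fragment of FO, given by a set of sentences (allowed in ontologies), for every $n$ a set of formulas $\varphi(x_1,\dots,x_n)$ (allowed for separation), a set of arities admitted in databases, and a set of lengths admitted for example tuples. $L$ *contains $\mathcal{ALCFIO}$* if it admits database arities $1,2$ and example length $1$, and every (translated) $\mathcal{ALCFIO}$ concept inclusion and functionality assertion is a sentence of $L$ and every $\mathcal{ALCFIO}$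 concept is a formula of $L$ with $n=1$ — literally, or more generally up to rewriting into an equivalent $L$-formula with the same relation symbols and constants, where the rewriting of ontology sentences is computable. A *labeled $L$-KB* $(\mathcal K,P,N)$ consists of $\mathcal K=(\mathcal O,\mathcal D)$, with $\mathcal O$ a finite set of $L$-sentences and $\mathcal D$ a finite set of ground atoms, and finite non-empty sets $P,N\subseteq \mathrm{cons}(\mathcal D)^n$, where $\mathrm{cons}(\mathcal D)$ is the set of constants in $\mathcal D$. Models are non-empty relational structures interpreting all symbols, without the unique name assumption; $\mathrm{sig}(\cdot)$ denotes the set of relation symbols that occur in an object. Let $\Sigma\subseteq\mathrm{sig}(\mathcal K)$. An $L$-formula $\varphi(x_1,\dots,x_n)$ in which no constant from $\mathrm{cons}(\mathcal D)$ occurs *$\Sigma$-separates* $(\mathcal K,P,N)$ if $\mathrm{sig}(\mathcal K)\cap\mathrm{sig}(\varphi)\subseteq\Sigma$, $\mathcal K\models\varphi(\vec a)$ for all $\vec a\in P$, and $\mathcal K\not\models\varphi(\vec a)$ for all $\vec a\in N$. $(\mathcal K,P,N)$ is *projectively $L(\Sigma)$-separable* if some $L$-formula $\Sigma$-separates it,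 and *non-projectively $L(\Sigma)$-separable* if some $L$-formula $\varphi$ with $\mathrm{sig}(\varphi)\subseteq\Sigma$ does. **Theorem.** For every logic $L$ that contains $\mathcal{ALCFIO}$, the following two problems are undecidable: given a labeled $L$-KB $(\mathcal K,P,N)$ and a signature $\Sigma\subseteq\mathrm{sig}(\mathcal K)$, decide whether $(\mathcal K,P,N)$ is (1) projectively $L(\Sigma)$-separable; (2) non-projectively $L(\Sigma)$-separable. That is, in either case there is no algorithm that returns the correct answer on all such inputs. -/

import Mathlib

namespace Separability

open FirstOrder FirstOrder.Language

/-! ### First-order logic: constants `c₀, c₁, …`, countably many relation symbols of each arity `≥ 1` -/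

/-- Function symbols: countably many constants and nothing else. -/
inductive FunSym : ℕ → Type
  | const (c : ℕ) : FunSym 0

/-- Relation symbols: the `k`-th relation symbol of arity `n + 1`. -/
inductive RelSym : ℕ → Type
  | mk (n k : ℕ) : RelSym (n + 1)

/-- The index of a relation symbol among the symbols of its arity. -/
def RelSym.idx : {n : ℕ} → RelSym n → ℕ
  | _, .mk _ k => k

/-- The full first-order vocabulary. -/
def Voc : FirstOrder.Language.{0, 0} := ⟨FunSym, RelSym⟩

/-- The `c`-th constant as a symbol of the vocabulary. -/
def constSym (c : ℕ) : Voc.Functions 0 := FunSym.const c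

/-- The `A`-th unary relation symbol (concept name). -/
def conceptName (A : ℕ) : Voc.Relations 1 := RelSym.mk 0 A

/-- The `r`-th binary relation symbol (role name). -/
def roleName (r : ℕ) : Voc.Relations 2 := RelSym.mk 1 r

/-- A relation symbol together with its arity. -/
abbrev Sym := Σ n : ℕ, Voc.Relations n

/-- A constant as a term. -/
def constTerm {β : Type} (c : ℕ) : Voc.Term β :=
  Term.func (constSym c) ![]

/-- The element denoted by the constant `c` in a structure. -/
def constVal (M : Type) [Voc.Structure M] (c : ℕ) : M :=
  Structure.funMap (constSym c) ![]

/-- The relation symbols occurring in a formula. -/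
def relSyms {α : Type} : {n : ℕ} → Voc.BoundedFormula α n → Set Sym
  | _, .falsum => ∅
  | _, .equal _ _ => ∅
  | _, .rel (l := l) R _ => {⟨l, R⟩}
  | _, .imp φ ψ => relSyms φ ∪ relSyms ψ
  | _, .all φ => relSyms φ

/-- The constants occurring in a term. -/
def termConsts {β : Type} : Voc.Term β → Set ℕ
  | .var _ => ∅
  | .func (FunSym.const c) _ => {c}

/-- The constants occurring in a formula. -/
def consts {α : Type} : {n : ℕ} → Voc.BoundedFormula α n → Set ℕ
  | _, .falsum => ∅
  | _, .equal t s => termConsts t ∪ termConsts s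
  | _, .rel _ ts => ⋃ i, termConsts (ts i)
  | _, .imp φ ψ => consts φ ∪ consts ψ
  | _, .all φ => consts φ

/-- Two formulas with the same free variables are equivalent if they agree in all structures. -/
def Equivalent {α : Type} (φ ψ : Voc.Formula α) : Prop :=
  ∀ (M : Type) [Voc.Structure M] [Nonempty M] (v : α → M), φ.Realize v ↔ ψ.Realize v

/-! ### Gödel numbers of sentences -/

/-- The Gödel number of a term whose variables are bound variables. -/
def termCode {n : ℕ} : Voc.Term (Empty ⊕ Fin n) → ℕ
  | .var (.inr i) => Nat.pair 0 i
  | .func (FunSym.const c) _ => Nat.pair 1 c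

/-- The Gödel number of a formula without free variables other than de Bruijn ones. -/
def fmlCode : {n : ℕ} → Voc.BoundedFormula Empty n → ℕ
  | _, .falsum => 0
  | _, .equal t s => Nat.pair 0 (Nat.pair (termCode t) (termCode s)) + 1
  | _, .rel (l := l) R ts =>
      Nat.pair 1 (Nat.pair l (Nat.pair (RelSym.idx R)
        (Encodable.encode (List.ofFn fun i => termCode (ts i))))) + 1
  | _, .imp φ ψ => Nat.pair 2 (Nat.pair (fmlCode φ) (fmlCode ψ)) + 1
  | _, .all φ => Nat.pair 3 (fmlCode φ) + 1

theorem RelSym.idx_injective {n : ℕ} : Function.Injective (RelSym.idx (n := n)) := by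
  rintro ⟨n, k⟩ ⟨_, k'⟩ h
  simpa [RelSym.idx] using h

theorem termCode_injective {n : ℕ} : Function.Injective (termCode (n := n)) := by
  intro t s h
  match t, s with
  | .var (.inr i), .var (.inr j) =>
    simp only [termCode, Nat.pair_eq_pair, true_and] at h
    rw [Fin.ext h]
  | .func (FunSym.const c) f, .func (FunSym.const d) g =>
    simp only [termCode, Nat.pair_eq_pair, true_and] at h
    subst h
    congr 1
    exact Subsingleton.elim _ _
  | .var (.inr i), .func (FunSym.const d) g =>
    simp [termCode, Nat.pair_eq_pair] at h
  | .func (FunSym.const c) f, .var (.inr j) =>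
    simp [termCode, Nat.pair_eq_pair] at h

/-- Different formulas have different Gödel numbers. -/
theorem fmlCode_injective {n : ℕ} : Function.Injective (fmlCode (n := n)) := by
  intro φ
  induction φ with
  | falsum => intro ψ h; cases ψ <;> simp [fmlCode] at h ⊢
  | equal t s =>
    intro ψ h
    cases ψ <;> simp [fmlCode, Nat.pair_eq_pair] at h ⊢
    exact ⟨termCode_injective h.1, termCode_injective h.2⟩
  | rel R ts =>
    intro ψ h
    cases ψ with
    | rel R' ts' =>
      simp only [fmlCode, Nat.add_right_cancel_iff, Nat.pair_eq_pair, true_and] at h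
      obtain ⟨h1, h2, h3⟩ := h
      subst h1
      obtain rfl := RelSym.idx_injective h2
      have h4 := List.ofFn_injective (Encodable.encode_injective h3)
      congr 1
      funext i
      exact termCode_injective (congrFun h4 i)
    | _ => simp [fmlCode, Nat.pair_eq_pair] at h
  | imp φ₁ φ₂ ih₁ ih₂ =>
    intro ψ h
    cases ψ with
    | imp ψ₁ ψ₂ =>
      simp only [fmlCode, Nat.add_right_cancel_iff, Nat.pair_eq_pair, true_and] at h
      rw [ih₁ h.1, ih₂ h.2]
    | _ => simp [fmlCode, Nat.pair_eq_pair] at h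
  | all φ ih =>
    intro ψ h
    cases ψ with
    | all ψ =>
      simp only [fmlCode, Nat.add_right_cancel_iff, Nat.pair_eq_pair, true_and] at h
      rw [ih h]
    | _ => simp [fmlCode, Nat.pair_eq_pair] at h

/-! ### Fragments of first-order logic -/

/-- A fragment of FO (with constants). A plain set `S` of FO-formulas gives a fragment: `sentences`
and `formulas n` are the members of `S` without free variables and with free variables among
`x₀, …, xₙ₋₁`. The two components are kept apart since the ontologies of a description logic
consist of concept inclusions, while its separating formulas are concepts. -/
structure Fragment where
  /-- the sentences that may occur in ontologies -/
  sentences : Set Voc.Sentence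
  /-- the formulas `φ(x₀, …, xₙ₋₁)` that may be used for separation -/
  formulas : (n : ℕ) → Set (Voc.Formula (Fin n))
  /-- the arities of relation symbols admitted in databases (`1` and `2` for description logics) -/
  dbArities : Set ℕ
  /-- the lengths of example tuples (only `1` for description logics) -/
  exArities : Set ℕ

/-- `L` contains `L₀`: all sentences and formulas of `L₀` belong to `L`, up to an (effective, in the
case of ontology sentences) rewriting into an equivalent `L`-formula over the same symbols. Plain
inclusion is the special case in which nothing is rewritten, see `Fragment.contains_of_subset`. -/
def Fragment.Contains (L L₀ : Fragment) : Prop :=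
  L₀.dbArities ⊆ L.dbArities ∧
  L₀.exArities ⊆ L.exArities ∧
  (∃ tr : ℕ → ℕ, Computable tr ∧ ∀ χ ∈ L₀.sentences, ∃ ψ ∈ L.sentences,
    fmlCode ψ = tr (fmlCode χ) ∧ Equivalent ψ χ ∧
      relSyms ψ = relSyms χ ∧ consts ψ = consts χ) ∧
  ∀ n, ∀ χ ∈ L₀.formulas n, ∃ φ ∈ L.formulas n,
    Equivalent φ χ ∧ relSyms φ = relSyms χ ∧ consts φ = consts χ

theorem Fragment.contains_of_subset {L L₀ : Fragment} (h₁ : L₀.sentences ⊆ L.sentences)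
    (h₂ : ∀ n, L₀.formulas n ⊆ L.formulas n) (h₃ : L₀.dbArities ⊆ L.dbArities)
    (h₄ : L₀.exArities ⊆ L.exArities) : L.Contains L₀ :=
  ⟨h₃, h₄, ⟨id, Computable.id, fun χ h => ⟨χ, h₁ h, rfl, fun _ _ _ _ => Iff.rfl, rfl, rfl⟩⟩,
    fun n χ h => ⟨χ, h₂ n h, fun _ _ _ _ => Iff.rfl, rfl, rfl⟩⟩

/-! ### The description logic ALCFIO -/

/-- Roles: role names (binary relation symbols) and their inverses. -/
inductive Role
  | name (r : ℕ)
  | inv (r : ℕ)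

/-- ALCIO-concepts: concept names (unary relation symbols), nominals `{o}`, negation, conjunction
and existential restriction over roles. -/
inductive Concept
  | name (A : ℕ)
  | nominal (o : ℕ)
  | neg (C : Concept)
  | conj (C D : Concept)
  | ex (R : Role) (C : Concept)

/-- The statements of ALCFIO-ontologies: concept inclusions `C ⊑ D` and functionality assertions
`⊤ ⊑ (≤ 1 R)`. -/
inductive Statement
  | incl (C D : Concept)
  | functional (R : Role)

/-- The atom `R(x, y)`, which is `r(y, x)` if `R` is the inverse of `r`. -/
def Role.toFO {α : Type} {n : ℕ} (R : Role) (x y : α ⊕ Fin n) : Voc.BoundedFormula α n :=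
  match R with
  | .name r => (roleName r).boundedFormula₂ (.var x) (.var y)
  | .inv r => (roleName r).boundedFormula₂ (.var y) (.var x)

/-- The standard translation of concepts into formulas with one distinguished variable `x`. -/
def Concept.toFO {α : Type} : Concept → {n : ℕ} → α ⊕ Fin n → Voc.BoundedFormula α n
  | .name A, _, x => (conceptName A).boundedFormula₁ (.var x)
  | .nominal o, _, x => Term.bdEqual (.var x) (constTerm o)
  | .neg C, _, x => ∼(C.toFO x)
  | .conj C D, _, x => C.toFO x ⊓ D.toFO x
  | .ex R C, n, x =>
      ∃' (R.toFO (Sum.map id Fin.castSucc x) (.inr (Fin.last n)) ⊓ C.toFO (.inr (Fin.last n)))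

/-- Concept inclusions become `∀ x (C(x) → D(x))`, functionality assertions become
`∀ x ∀ y ∀ z (R(x,y) ∧ R(x,z) → y = z)`. -/
def Statement.toFO : Statement → Voc.Sentence
  | .incl C D => ∀' (C.toFO (n := 1) (.inr 0) ⟹ D.toFO (n := 1) (.inr 0))
  | .functional R =>
      ∀' ∀' ∀' ((R.toFO (n := 3) (.inr 0) (.inr 1) ⊓ R.toFO (n := 3) (.inr 0) (.inr 2)) ⟹
        Term.bdEqual (.var (.inr 1)) (.var (.inr 2)))

/-- ALCFIO as a fragment of FO. -/
def ALCFIO : Fragment where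
  sentences := Set.range Statement.toFO
  formulas
    | 1 => Set.range fun C : Concept => C.toFO (.inl 0)
    | _ => ∅
  dbArities := {1, 2}
  exArities := {1}

/-! ### Databases, knowledge bases and separability -/

/-- A ground atom `R(c₁, …, cₙ)`. -/
structure GroundAtom where
  /-- the arity -/
  arity : ℕ
  /-- the relation symbol -/
  rel : Voc.Relations arity
  /-- the constants -/
  args : Fin arity → ℕ

/-- An input of the separability problems: an ontology, a database, positive and negative examples
(tuples of constants of length `n`), and a signature. All these finite sets are given as lists. -/
structure Input where
  /-- the ontology -/
  onto : List Voc.Sentence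
  /-- the database -/
  db : List GroundAtom
  /-- the length of the example tuples -/
  n : ℕ
  /-- the positive examples -/
  pos : List (Fin n → ℕ)
  /-- the negative examples -/
  neg : List (Fin n → ℕ)
  /-- the signature of symbols admitted for separation -/
  sig : List Sym

namespace Input

/-- The constants that occur in the database. -/
def dbConsts (I : Input) : Set ℕ := {c | ∃ a ∈ I.db, c ∈ Set.range a.args}

/-- The relation symbols that occur in the knowledge base. -/
def kbSyms (I : Input) : Set Sym :=
  {S | (∃ ψ ∈ I.onto, S ∈ relSyms ψ) ∨ ∃ a ∈ I.db, S = ⟨a.arity, a.rel⟩}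

/-- The signature as a set. -/
def sigSet (I : Input) : Set Sym := {S | S ∈ I.sig}

/-- `I` is an input for `L`-separability with signature: a labeled `L`-KB with non-empty sets of
examples, which are tuples of database constants, and a signature contained in that of the KB. -/
structure IsLabeledKB (L : Fragment) (I : Input) : Prop where
  onto_mem : ∀ ψ ∈ I.onto, ψ ∈ L.sentences
  db_arity : ∀ a ∈ I.db, a.arity ∈ L.dbArities
  ex_arity : I.n ∈ L.exArities
  pos_ne : I.pos ≠ []
  neg_ne : I.neg ≠ []
  pos_mem : ∀ p ∈ I.pos, ∀ i, p i ∈ I.dbConsts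
  neg_mem : ∀ p ∈ I.neg, ∀ i, p i ∈ I.dbConsts
  sig_subset : I.sigSet ⊆ I.kbSyms

/-- `M` is a model of the knowledge base of `I` (no unique name assumption). -/
def IsModel (I : Input) (M : Type) [Voc.Structure M] : Prop :=
  (∀ ψ ∈ I.onto, M ⊨ ψ) ∧
    ∀ a ∈ I.db, Structure.RelMap a.rel fun i => constVal M (a.args i)

/-- The knowledge base of `I` entails `φ(c₁, …, cₙ)`. -/
def Entails (I : Input) (φ : Voc.Formula (Fin I.n)) (c : Fin I.n → ℕ) : Prop :=
  ∀ (M : Type) [Voc.Structure M] [Nonempty M], I.IsModel M → φ.Realize fun i => constVal M (c i)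

/-- `φ` separates the labeled KB with respect to the signature: it shares only symbols of the
signature with the KB, mentions no constant of the database, is entailed at all positive examples
and at no negative example. -/
structure Separates (I : Input) (φ : Voc.Formula (Fin I.n)) : Prop where
  syms : relSyms φ ∩ I.kbSyms ⊆ I.sigSet
  consts : Disjoint (consts φ) I.dbConsts
  pos : ∀ c ∈ I.pos, I.Entails φ c
  neg : ∀ c ∈ I.neg, ¬ I.Entails φ c

/-- Projective separability: fresh helper relation symbols are admitted. -/
def ProjectivelySeparable (L : Fragment) (I : Input) : Prop :=
  ∃ φ ∈ L.formulas I.n, I.Separates φ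

/-- Non-projective separability: the relation symbols of the formula are from the signature. -/
def Separable (L : Fragment) (I : Input) : Prop :=
  ∃ φ ∈ L.formulas I.n, I.Separates φ ∧ relSyms φ ⊆ I.sigSet

end Input

/-! ### Decision problems -/

/-- Finite data by which inputs are presented to algorithms. -/
abbrev RawInput :=
  List ℕ × List (ℕ × ℕ × List ℕ) × ℕ × List (List ℕ) × List (List ℕ) × List (ℕ × ℕ)

/-- The presentation of an input as finite data; sentences are given by their Gödel numbers. -/
def Input.raw (I : Input) : RawInput :=
  (I.onto.map fmlCode,
   I.db.map fun a => (a.arity, RelSym.idx a.rel, List.ofFn a.args),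
   I.n,
   I.pos.map fun p => List.ofFn p,
   I.neg.map fun p => List.ofFn p,
   I.sig.map fun S => (S.1, RelSym.idx S.2))

/-- Different inputs have different presentations. -/
theorem Input.raw_injective : Function.Injective Input.raw := by
  rintro ⟨o, d, n, p, q, s⟩ ⟨o', d', n', p', q', s'⟩ h
  simp only [Input.raw, Prod.mk.injEq] at h
  obtain ⟨h1, h2, h3, h4, h5, h6⟩ := h
  subst h3
  have e1 := List.map_injective_iff.2 fmlCode_injective h1
  have e4 := List.map_injective_iff.2 List.ofFn_injective h4
  have e5 := List.map_injective_iff.2 List.ofFn_injective h5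
  have e2 : d = d' := by
    refine List.map_injective_iff.2 ?_ h2
    rintro ⟨m, R, a⟩ ⟨m', R', a'⟩ h
    simp only [Prod.mk.injEq] at h
    obtain ⟨g1, g2, g3⟩ := h
    subst g1
    rw [RelSym.idx_injective g2, List.ofFn_injective g3]
  have e6 : s = s' := by
    refine List.map_injective_iff.2 ?_ h6
    rintro ⟨m, R⟩ ⟨m', R'⟩ h
    simp only [Prod.mk.injEq] at h
    obtain ⟨g1, g2⟩ := h
    subst g1
    rw [RelSym.idx_injective g2]
  subst e1 e2 e4 e5 e6
  rfl

/-- The problem of deciding `Q` on the inputs satisfying `V` is undecidable: no algorithm gives the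
right answer on all inputs that satisfy `V` (whatever it does elsewhere). -/
def Undecidable (V Q : Input → Prop) : Prop :=
  ¬ ∃ f : RawInput → Bool, Computable f ∧ ∀ I, V I → (f I.raw = true ↔ Q I)

end Separability

namespace Separability

open FirstOrder FirstOrder.Language

/-! ### Set-theoretic semantics of concepts -/

/-! The halting problem reduces to separability. Fix a code `c` for which halting on `[n]` is
undecidable in `n`. A terminating evaluation is a finite graph with functional roles: numbers and
lists are chains, and an evaluation points to its input, its output and its subevaluations.
Correctness of such a graph is a local matter, up to equations saying that two paths end in the same
element. An element is good if no infinite path starts at it and no defect (a violated local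
condition or path equation) is reachable. Then `c` halts on `[n]` iff some functional graph has a
good element satisfying `root c n` (`dom_of_good`, `exists_good_of_dom`); well-foundedness plays the
role of termination.

Separability has to express that a good root exists. The positive example is the constant 0, the
negative one the constant 1. The ontology makes the roles functional, puts a trace on every
positively labeled root, and requires each element with a trace to show a defect or to have a
successor with a trace. A violated path equation is witnessed by a mark that holds at the end of one
path and fails at the end of the other. Trace, mark and the labels of the two examples lie outside
the signature.

If there is a good root, the part reachable from it is finite, and a concept `T` describes it
completely, with a fresh nominal for each element. Where `T` holds, a trace can neither run forever
nor meet a defect: the nominals force path ends that coincide in the good graph to coincide, so that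
no mark tells them apart. Hence `¬T` is entailed at 0, while some model satisfies `T` at 1
(`separable_of_good`).

If there is no good root, take any model, move the constant 0 onto the element denoted by 1, and
reinterpret the positive label, the trace and the mark; as that element is no good root, a suitable
trace and mark exist (`exists_trace`). A formula that avoids the changed symbols and the database
constants does not notice, so if it is entailed at 0 it is entailed at 1
(`projectivelySeparable_imp`).

The first case yields separability without helper symbols, the second excludes it even with them, so
the same instances settle both problems. Only the inclusion for the root depends on `n`, and its
Gödel number is primitive recursive in `n`. -/

/-- Interpretations of concept names, role names and nominals on a domain. -/
structure Interp (V : Type) where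
  /-- the interpretation of concept names -/
  lab : ℕ → V → Prop
  /-- the interpretation of role names -/
  edge : ℕ → V → V → Prop
  /-- the interpretation of constants -/
  nom : ℕ → V

/-- The elements that satisfy a concept. -/
def Interp.sat {V : Type} (I : Interp V) : Concept → V → Prop
  | .name A, x => I.lab A x
  | .nominal o, x => x = I.nom o
  | .neg C, x => ¬ I.sat C x
  | .conj C D, x => I.sat C x ∧ I.sat D x
  | .ex (.name r) C, x => ∃ y, I.edge r x y ∧ I.sat C y
  | .ex (.inv r) C, x => ∃ y, I.edge r y x ∧ I.sat C y

/-- The interpretation underlying a first-order structure. -/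
def Interp.of (M : Type) [Voc.Structure M] : Interp M where
  lab A x := Structure.RelMap (conceptName A) ![x]
  edge r x y := Structure.RelMap (roleName r) ![x, y]
  nom := constVal M

theorem realize_constTerm {M : Type} [Voc.Structure M] {β : Type} (v : β → M) (c : ℕ) :
    (constTerm c : Voc.Term β).realize v = constVal M c := by
  simp only [constTerm, constVal, Term.realize]
  congr 1
  exact Subsingleton.elim _ _

theorem elim_snoc_castSucc {α M : Type} {n : ℕ} (v : α → M) (xs : Fin n → M) (y : M)
    (x : α ⊕ Fin n) :
    Sum.elim v (Fin.snoc xs y : Fin (n + 1) → M) (Sum.map id Fin.castSucc x) =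
      Sum.elim v xs x := by
  rcases x with x | x <;> simp

theorem realize_concept {M : Type} [Voc.Structure M] {α : Type} (C : Concept) {n : ℕ}
    (x : α ⊕ Fin n) (v : α → M) (xs : Fin n → M) :
    (C.toFO x).Realize v xs ↔ (Interp.of M).sat C (Sum.elim v xs x) := by
  induction C generalizing n with
  | name A => simp [Concept.toFO, Interp.sat, Interp.of, BoundedFormula.realize_rel₁]
  | nominal o =>
    simp [Concept.toFO, Interp.sat, Interp.of, BoundedFormula.realize_bdEqual, realize_constTerm]
  | neg C ih => simp [Concept.toFO, Interp.sat, ih]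
  | conj C D ih₁ ih₂ => simp [Concept.toFO, Interp.sat, ih₁, ih₂]
  | ex R C ih =>
    cases R <;>
    simp [Concept.toFO, Role.toFO, Interp.sat, Interp.of, BoundedFormula.realize_rel₂, ih,
      elim_snoc_castSucc]

/-- Validity of a statement in an interpretation. -/
def Interp.models {V : Type} (I : Interp V) : Statement → Prop
  | .incl C D => ∀ x, I.sat C x → I.sat D x
  | .functional (.name r) => ∀ x y z, I.edge r x y → I.edge r x z → y = z
  | .functional (.inv r) => ∀ x y z, I.edge r y x → I.edge r z x → y = z

theorem realize_statement {M : Type} [Voc.Structure M] (s : Statement) :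
    M ⊨ s.toFO ↔ (Interp.of M).models s := by
  cases s with
  | incl C D =>
    simp [Statement.toFO, Interp.models, Sentence.Realize, Formula.Realize, realize_concept,
      Fin.snoc]
  | functional R =>
    cases R <;>
    simp [Statement.toFO, Interp.models, Sentence.Realize, Formula.Realize, Role.toFO, Fin.snoc,
      BoundedFormula.realize_rel₂, Interp.of]

/-! ### Symbols of concepts -/

/-- The relation symbols of a concept. -/
def Concept.syms : Concept → Set Sym
  | .name A => {⟨1, conceptName A⟩}
  | .nominal _ => ∅
  | .neg C => C.syms
  | .conj C D => C.syms ∪ D.syms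
  | .ex (.name r) C => {⟨2, roleName r⟩} ∪ C.syms
  | .ex (.inv r) C => {⟨2, roleName r⟩} ∪ C.syms

/-- The constants of a concept. -/
def Concept.noms : Concept → Set ℕ
  | .name _ => ∅
  | .nominal o => {o}
  | .neg C => C.noms
  | .conj C D => C.noms ∪ D.noms
  | .ex _ C => C.noms

theorem relSyms_concept {α : Type} (C : Concept) {n : ℕ} (x : α ⊕ Fin n) :
    relSyms (C.toFO x) = C.syms := by
  induction C generalizing n with
  | name A => rfl
  | nominal o => rfl
  | neg C ih =>
    -- Negation is implication to falsum, which contributes the empty set; conjunction and `∃'`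
    -- unfold to nested negations in the same way.
    show relSyms (C.toFO x) ∪ ∅ = _
    simp [ih, Concept.syms]
  | conj C D ih₁ ih₂ =>
    show (relSyms (C.toFO x) ∪ (relSyms (D.toFO x) ∪ ∅)) ∪ ∅ = _
    simp [ih₁, ih₂, Concept.syms]
  | ex R C ih =>
    cases R <;>
    · show ((({_} ∪ (relSyms (C.toFO _) ∪ ∅)) ∪ ∅) ∪ ∅) ∪ ∅ = _
      simp [ih, Concept.syms]

theorem consts_concept {α : Type} (C : Concept) {n : ℕ} (x : α ⊕ Fin n) :
    consts (C.toFO x) = C.noms := by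
  induction C generalizing n with
  | name A =>
    show (⋃ i, termConsts ((![Term.var x] : Fin 1 → Voc.Term (α ⊕ Fin n)) i)) = ∅
    simp [termConsts]
  | nominal o =>
    show ∅ ∪ {o} = _
    simp [Concept.noms]
  | neg C ih =>
    show consts (C.toFO x) ∪ ∅ = _
    simp [ih, Concept.noms]
  | conj C D ih₁ ih₂ =>
    show (consts (C.toFO x) ∪ (consts (D.toFO x) ∪ ∅)) ∪ ∅ = _
    simp [ih₁, ih₂, Concept.noms]
  | ex R C ih =>
    cases R <;>
    · show ((((⋃ i, termConsts ((![Term.var _, Term.var _] :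
          Fin 2 → Voc.Term (α ⊕ Fin (n + 1))) i)) ∪ (consts (C.toFO _) ∪ ∅)) ∪ ∅) ∪ ∅) ∪ ∅ = _
      simp [ih, Concept.noms, termConsts]

/-! ### Formulas only depend on the symbols that occur in them -/

theorem realize_term_congr {M : Type} (S S' : Voc.Structure M) {β : Type} (t : Voc.Term β)
    (h : ∀ c ∈ termConsts t, @constVal M S c = @constVal M S' c) (v : β → M) :
    @Term.realize Voc M S β v t = @Term.realize Voc M S' β v t := by
  match t with
  | .var x => rfl
  | .func (FunSym.const c) ts =>
    obtain rfl : ts = ![] := Subsingleton.elim _ _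
    have h1 := @realize_constTerm M S β v c
    have h2 := @realize_constTerm M S' β v c
    exact h1.trans ((h c rfl).trans h2.symm)

/-- This is what keeps a separating formula from noticing a change of constants and symbols that it
does not mention. -/
theorem realize_congr {M : Type} (S S' : Voc.Structure M) {α : Type} {n : ℕ}
    (φ : Voc.BoundedFormula α n)
    (hc : ∀ c ∈ consts φ, @constVal M S c = @constVal M S' c)
    (hr : ∀ m (R : Voc.Relations m), (⟨m, R⟩ : Sym) ∈ relSyms φ → ∀ xs : Fin m → M,
      @Structure.RelMap Voc M S m R xs ↔ @Structure.RelMap Voc M S' m R xs)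
    (v : α → M) (xs : Fin n → M) :
    @BoundedFormula.Realize Voc M S α n φ v xs ↔ @BoundedFormula.Realize Voc M S' α n φ v xs := by
  induction φ with
  | falsum => rfl
  | equal t s =>
    simp only [BoundedFormula.Realize]
    rw [realize_term_congr S S' t fun c h => hc c (.inl h),
      realize_term_congr S S' s fun c h => hc c (.inr h)]
  | rel R ts =>
    simp only [BoundedFormula.Realize]
    rw [hr _ R rfl]
    have : ∀ i, @Term.realize Voc M S _ (Sum.elim v xs) (ts i) =
        @Term.realize Voc M S' _ (Sum.elim v xs) (ts i) := fun i =>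
      realize_term_congr S S' (ts i) (fun c h => hc c (Set.mem_iUnion.2 ⟨i, h⟩)) _
    simp only [this]
  | imp φ ψ ih₁ ih₂ =>
    simp only [BoundedFormula.Realize]
    rw [ih₁ (fun c h => hc c (.inl h)) (fun m R h => hr m R (.inl h)),
      ih₂ (fun c h => hc c (.inr h)) (fun m R h => hr m R (.inr h))]
  | all φ ih =>
    simp only [BoundedFormula.Realize]
    exact forall_congr' fun y => ih hc hr _

/-! ### Derived concepts and paths -/

namespace Concept

/-- The concept satisfied by everything. -/
def top : Concept := .neg (.conj (.name 0) (.neg (.name 0)))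

/-- Disjunction. -/
def disj (C D : Concept) : Concept := .neg (.conj (.neg C) (.neg D))

/-- Disjunction of a list. -/
def bigDisj : List Concept → Concept
  | [] => .neg top
  | C :: l => C.disj (bigDisj l)

/-- Conjunction of a list. -/
def bigConj : List Concept → Concept
  | [] => top
  | C :: l => C.conj (bigConj l)

/-- Existential restriction over a role name. -/
def dia (r : ℕ) (C : Concept) : Concept := .ex (.name r) C

/-- Existential restriction along a path of role names. -/
def along (p : List ℕ) (C : Concept) : Concept := p.foldr dia C

/-- Concepts without nominals and inverse roles whose concept names are below `l` and whose role
names are below `k`. -/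
def Plain (l k : ℕ) : Concept → Prop
  | .name A => A < l
  | .nominal _ => False
  | .neg C => C.Plain l k
  | .conj C D => C.Plain l k ∧ D.Plain l k
  | .ex (.name r) C => r < k ∧ C.Plain l k
  | .ex (.inv _) _ => False

end Concept

namespace Interp

variable {V : Type} (I : Interp V)

/-- Reachability along a path of role names. -/
def path : List ℕ → V → V → Prop
  | [], x, y => x = y
  | r :: p, x, y => ∃ z, I.edge r x z ∧ path p z y

@[simp] theorem sat_name (A : ℕ) (x : V) : I.sat (.name A) x ↔ I.lab A x := Iff.rfl
@[simp] theorem sat_nominal (o : ℕ) (x : V) : I.sat (.nominal o) x ↔ x = I.nom o := Iff.rfl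
@[simp] theorem sat_neg (C : Concept) (x : V) : I.sat (.neg C) x ↔ ¬ I.sat C x := Iff.rfl
@[simp] theorem sat_conj (C D : Concept) (x : V) :
    I.sat (.conj C D) x ↔ I.sat C x ∧ I.sat D x := Iff.rfl
@[simp] theorem sat_top (x : V) : I.sat .top x := by simp [Concept.top]
@[simp] theorem sat_disj (C D : Concept) (x : V) :
    I.sat (C.disj D) x ↔ I.sat C x ∨ I.sat D x := by simp [Concept.disj]; tauto
@[simp] theorem sat_dia (r : ℕ) (C : Concept) (x : V) :
    I.sat (.dia r C) x ↔ ∃ y, I.edge r x y ∧ I.sat C y := Iff.rfl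

theorem sat_bigDisj (l : List Concept) (x : V) :
    I.sat (.bigDisj l) x ↔ ∃ C ∈ l, I.sat C x := by
  induction l with
  | nil => simp [Concept.bigDisj]
  | cons C l ih => simp [Concept.bigDisj, ih]

theorem sat_bigConj (l : List Concept) (x : V) :
    I.sat (.bigConj l) x ↔ ∀ C ∈ l, I.sat C x := by
  induction l with
  | nil => simp [Concept.bigConj]
  | cons C l ih => simp [Concept.bigConj, ih]

theorem sat_along (p : List ℕ) (C : Concept) (x : V) :
    I.sat (.along p C) x ↔ ∃ y, I.path p x y ∧ I.sat C y := by
  induction p generalizing x with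
  | nil => simp [Concept.along, path]
  | cons r p ih =>
    show I.sat (.dia r (.along p C)) x ↔ _
    simp only [sat_dia, ih, path]
    constructor
    · rintro ⟨z, h, y, h', h''⟩
      exact ⟨y, ⟨z, h, h'⟩, h''⟩
    · rintro ⟨y, ⟨z, h, h'⟩, h''⟩
      exact ⟨z, h, y, h', h''⟩

/-- Plain concepts are invariant under bisimulations. -/
theorem sat_iff_of_bisim {V W : Type} {I : Interp V} {J : Interp W} {l k : ℕ} (Z : V → W → Prop)
    (hl : ∀ x y, Z x y → ∀ A < l, I.lab A x ↔ J.lab A y)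
    (hf : ∀ x y, Z x y → ∀ r < k, ∀ x', I.edge r x x' → ∃ y', J.edge r y y' ∧ Z x' y')
    (hb : ∀ x y, Z x y → ∀ r < k, ∀ y', J.edge r y y' → ∃ x', I.edge r x x' ∧ Z x' y')
    {C : Concept} (hC : C.Plain l k) {x : V} {y : W} (h : Z x y) : I.sat C x ↔ J.sat C y := by
  induction C generalizing x y with
  | name A => exact hl x y h A hC
  | nominal o => exact hC.elim
  | neg C ih => exact not_congr (ih hC h)
  | conj C D ih₁ ih₂ => exact and_congr (ih₁ hC.1 h) (ih₂ hC.2 h)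
  | ex R C ih =>
    cases R with
    | inv r => exact hC.elim
    | name r =>
      constructor
      · rintro ⟨x', h1, h2⟩
        obtain ⟨y', h3, h4⟩ := hf x y h r hC.1 x' h1
        exact ⟨y', h3, (ih hC.2 h4).1 h2⟩
      · rintro ⟨y', h1, h2⟩
        obtain ⟨x', h3, h4⟩ := hb x y h r hC.1 y' h1
        exact ⟨x', h3, (ih hC.2 h4).2 h2⟩

theorem sat_congr {J : Interp V} {I : Interp V} {l k : ℕ} (hl : ∀ A < l, ∀ x, I.lab A x ↔ J.lab A x)
    (he : ∀ r x y, I.edge r x y ↔ J.edge r x y) {C : Concept} (hC : C.Plain l k) (x : V) :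
    I.sat C x ↔ J.sat C x :=
  sat_iff_of_bisim (Z := Eq) (by rintro x _ rfl A hA; exact hl A hA x)
    (by rintro x _ rfl r _ y h; exact ⟨y, (he r x y).1 h, rfl⟩)
    (by rintro x _ rfl r _ y h; exact ⟨y, (he r x y).2 h, rfl⟩) hC rfl

theorem path_congr {I J : Interp V} (he : ∀ r x y, I.edge r x y ↔ J.edge r x y) (p : List ℕ)
    (x y : V) : I.path p x y ↔ J.path p x y := by
  induction p generalizing x with
  | nil => rfl
  | cons r p ih => simp only [path, he, ih]

end Interp

/-! ### Defects of functional graphs -/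

/-- A specification of defects of graphs with labels `< l` and roles `< k`: an element is defective
if it satisfies one of the concepts in `bad`, or if, for some `(C, p, q)` in `eqs`, it satisfies `C`
and the paths `p` and `q` lead to different elements. -/
structure DefectSpec where
  /-- the number of labels -/
  l : ℕ
  /-- the number of roles -/
  k : ℕ
  /-- the defects given by concepts -/
  bad : List Concept
  /-- the defects given by path equations -/
  eqs : List (Concept × List ℕ × List ℕ)
  bad_plain : ∀ C ∈ bad, C.Plain l k
  eqs_plain : ∀ e ∈ eqs, e.1.Plain l k

namespace DefectSpec

variable (S : DefectSpec)

/-- The roles are functional. -/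
def Functional {V : Type} (I : Interp V) : Prop :=
  ∀ r < S.k, ∀ x y z, I.edge r x y → I.edge r x z → y = z

/-- The violation of a path equation. -/
def EqDefect {V : Type} (I : Interp V) (x : V) : Prop :=
  ∃ e ∈ S.eqs, I.sat e.1 x ∧ ∃ y z, I.path e.2.1 x y ∧ I.path e.2.2 x z ∧ y ≠ z

/-- An element without defects from which no infinite path starts and no defect is reachable. -/
inductive Good {V : Type} (I : Interp V) : V → Prop
  | mk (x : V) (bad : ∀ C ∈ S.bad, ¬ I.sat C x) (eqs : ¬ S.EqDefect I x)
      (succ : ∀ r < S.k, ∀ y, I.edge r x y → Good I y) : Good I x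

/-! ### The knowledge base of a defect specification -/

/-- The name that labels the positive example. -/
def posName : ℕ := S.l
/-- The name that marks a path to a defect. -/
def traceName : ℕ := S.l + 1
/-- The name that tells apart the ends of two paths. -/
def markName : ℕ := S.l + 2
/-- The name that labels the negative example. -/
def negName : ℕ := S.l + 3

/-- The concept expressing that two paths lead to elements told apart by the mark. -/
def eqConcept (e : Concept × List ℕ × List ℕ) : Concept :=
  e.1.conj ((Concept.along e.2.1 (.name S.markName)).conj
    (Concept.along e.2.2 (.neg (.name S.markName))))

/-- The reasons for being on a path to a defect. -/
def traceConcept : Concept :=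
  .bigDisj (S.bad ++ (S.eqs.map S.eqConcept ++
    (List.range S.k).map fun r => .dia r (.name S.traceName)))

/-- The part of the ontology that does not depend on the root concept. -/
def baseOnto : List Statement :=
  (List.range S.k).map (fun r => .functional (.name r)) ++
    ((List.range (S.l + 3)).map (fun A => .incl (.name A) (.name A)) ++
      [.incl (.name S.traceName) S.traceConcept])

/-- Positive examples satisfying the root concept are on a path to a defect. -/
def rootStatement (R : Concept) : Statement :=
  .incl (.conj (.name S.posName) R) (.name S.traceName)

/-- The database. -/
def db : List GroundAtom :=
  [⟨1, conceptName S.posName, ![0]⟩, ⟨1, conceptName S.negName, ![1]⟩]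

/-- The signature. -/
def sig : List Sym :=
  (List.range S.l).map (fun A => ⟨1, conceptName A⟩) ++
    (List.range S.k).map (fun r => ⟨2, roleName r⟩)

/-- The separability input with a given ontology. -/
def input (onto : List Voc.Sentence) : Input where
  onto := onto
  db := S.db
  n := 1
  pos := [![0] ]
  neg := [![1] ]
  sig := S.sig

theorem mem_dbConsts (onto : List Voc.Sentence) (c : ℕ) :
    c ∈ (S.input onto).dbConsts ↔ c = 0 ∨ c = 1 := by
  simp [Input.dbConsts, input, db, eq_comm]

theorem label_mem_sigSet (onto : List Voc.Sentence) (A : ℕ) :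
    (⟨1, conceptName A⟩ : Sym) ∈ (S.input onto).sigSet ↔ A < S.l := by
  simp only [Input.sigSet, input, sig, Set.mem_ofPred_eq, List.mem_append, List.mem_map,
    List.mem_range]
  constructor
  · rintro (⟨a, ha, h⟩ | ⟨r, _, h⟩)
    · cases h
      exact ha
    · cases h
  · exact fun h => .inl ⟨A, h, rfl⟩

theorem mem_sigSet (onto : List Voc.Sentence) (s : Sym) : s ∈ (S.input onto).sigSet ↔
    (∃ A < S.l, ⟨1, conceptName A⟩ = s) ∨ ∃ r < S.k, ⟨2, roleName r⟩ = s := by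
  simp [Input.sigSet, input, sig]

/-- `onto` consists of sentences of `L` equivalent to the statements in `O`. -/
def _root_.Separability.Rewrites (L : Fragment) (onto : List Voc.Sentence) (O : List Statement) :
    Prop :=
  (∀ ψ ∈ onto, ψ ∈ L.sentences) ∧
  (∀ ψ ∈ onto, ∃ s ∈ O, Equivalent ψ s.toFO) ∧
  ∀ s ∈ O, ∃ ψ ∈ onto, Equivalent ψ s.toFO ∧ relSyms ψ = relSyms s.toFO

theorem _root_.Separability.Rewrites.models_iff {L : Fragment} {onto : List Voc.Sentence}
    {O : List Statement} (h : Rewrites L onto O) (M : Type) [Voc.Structure M] [Nonempty M] :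
    (∀ ψ ∈ onto, M ⊨ ψ) ↔ ∀ s ∈ O, (Interp.of M).models s := by
  constructor
  · intro h1 s hs
    obtain ⟨ψ, h2, h3, _⟩ := h.2.2 s hs
    exact (realize_statement s).1 ((h3 M default).1 (h1 ψ h2))
  · intro h1 ψ hψ
    obtain ⟨s, h2, h3⟩ := h.2.1 ψ hψ
    exact (h3 M default).2 ((realize_statement s).2 (h1 s h2))

variable {L : Fragment} {onto : List Voc.Sentence} {R : Concept}

/-- The trivial inclusions `A ⊑ A` in `baseOnto` serve only this purpose. With them the signature is
legal, and the positive label, trace and mark belong to the knowledge base, so that a separating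
formula may not use them as helper symbols. -/
theorem label_mem_kbSyms (h : Rewrites L onto (S.rootStatement R :: S.baseOnto)) {A : ℕ}
    (hA : A < S.l + 3) : (⟨1, conceptName A⟩ : Sym) ∈ (S.input onto).kbSyms := by
  obtain ⟨ψ, h1, _, h2⟩ := h.2.2 (.incl (.name A) (.name A)) (by simp [baseOnto, hA])
  refine .inl ⟨ψ, h1, ?_⟩
  rw [h2]
  exact .inl rfl

theorem role_mem_kbSyms (h : Rewrites L onto (S.rootStatement R :: S.baseOnto)) {r : ℕ}
    (hr : r < S.k) : (⟨2, roleName r⟩ : Sym) ∈ (S.input onto).kbSyms := by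
  obtain ⟨ψ, h1, _, h2⟩ := h.2.2 (.functional (.name r)) (by simp [baseOnto, hr])
  refine .inl ⟨ψ, h1, ?_⟩
  rw [h2]
  exact .inl (.inl (.inl rfl))

theorem isLabeledKB (hL : L.Contains ALCFIO)
    (h : Rewrites L onto (S.rootStatement R :: S.baseOnto)) :
    (S.input onto).IsLabeledKB L where
  onto_mem := h.1
  db_arity a ha := hL.1 (by
    simp only [input, db, List.mem_cons, List.not_mem_nil, or_false] at ha
    rcases ha with rfl | rfl <;> simp [ALCFIO])
  ex_arity := hL.2.1 rfl
  pos_ne := by simp [input]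
  neg_ne := by simp [input]
  pos_mem p hp i := by
    rw [S.mem_dbConsts]
    obtain rfl : p = ![0] := List.mem_singleton.1 hp
    left
    exact congrFun (Matrix.cons_fin_one 0 _ : ![0] = fun _ => 0) i
  neg_mem p hp i := by
    rw [S.mem_dbConsts]
    obtain rfl : p = ![1] := List.mem_singleton.1 hp
    right
    exact congrFun (Matrix.cons_fin_one 1 _ : ![1] = fun _ => 1) i
  sig_subset s hs := by
    rcases (S.mem_sigSet onto s).1 hs with ⟨A, hA, rfl⟩ | ⟨r, hr, rfl⟩
    · exact S.label_mem_kbSyms h (by omega)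
    · exact S.role_mem_kbSyms h hr

theorem isModel_iff (h : Rewrites L onto (S.rootStatement R :: S.baseOnto)) (M : Type)
    [Voc.Structure M] [Nonempty M] : (S.input onto).IsModel M ↔
      S.Functional (Interp.of M) ∧
      (∀ x, (Interp.of M).lab S.traceName x → (Interp.of M).sat S.traceConcept x) ∧
      (∀ x, (Interp.of M).lab S.posName x → (Interp.of M).sat R x →
        (Interp.of M).lab S.traceName x) ∧
      (Interp.of M).lab S.posName (constVal M 0) ∧
      (Interp.of M).lab S.negName (constVal M 1) := by
  have e : ∀ c : ℕ, (fun i => constVal M ((![c] : Fin 1 → ℕ) i)) = ![constVal M c] := by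
    intro c
    funext i
    fin_cases i
    rfl
  have hd : (∀ a ∈ (S.input onto).db, Structure.RelMap a.rel fun i => constVal M (a.args i)) ↔
      (Interp.of M).lab S.posName (constVal M 0) ∧
      (Interp.of M).lab S.negName (constVal M 1) := by
    simp only [input, db, List.forall_mem_cons, List.not_mem_nil, false_imp_iff, implies_true,
      and_true, e]
    rfl
  rw [Input.IsModel, hd]
  have ho := h.models_iff M
  rw [show (S.input onto).onto = onto from rfl, ho]
  simp only [baseOnto, List.forall_mem_cons, List.forall_mem_append, List.forall_mem_map,
    List.mem_range, List.not_mem_nil, false_imp_iff, implies_true, and_true, rootStatement,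
    Interp.models, Interp.sat_conj, Interp.sat_name, and_imp, true_and, imp_self]
  unfold Functional
  tauto

theorem sat_traceConcept {V : Type} (I : Interp V) (x : V) : I.sat S.traceConcept x ↔
    (∃ C ∈ S.bad, I.sat C x) ∨
    (∃ e ∈ S.eqs, I.sat e.1 x ∧ (∃ y, I.path e.2.1 x y ∧ I.lab S.markName y) ∧
      ∃ z, I.path e.2.2 x z ∧ ¬ I.lab S.markName z) ∨
    ∃ r < S.k, ∃ y, I.edge r x y ∧ I.lab S.traceName y := by
  simp only [traceConcept, Interp.sat_bigDisj, List.mem_append, List.mem_map, List.mem_range,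
    or_and_right, exists_or, exists_exists_and_eq_and, eqConcept, Interp.sat_conj,
    Interp.sat_along, Interp.sat_dia, Interp.sat_name, Interp.sat_neg]

/-! ### Without good roots there is no separation -/

/-- One-step reachability. -/
def Step {V : Type} (I : Interp V) (x y : V) : Prop := ∃ r < S.k, I.edge r x y

/-- If `x` is not good, then there are a trace from `x` and a mark that witness this. -/
theorem exists_trace {V : Type} (I : Interp V) (x : V) (hx : ¬ S.Good I x) :
    ∃ D P : V → Prop, D x ∧ ∀ y, D y → (∃ C ∈ S.bad, I.sat C y) ∨
      (∃ e ∈ S.eqs, I.sat e.1 y ∧ (∃ z, I.path e.2.1 y z ∧ P z) ∧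
        ∃ z, I.path e.2.2 y z ∧ ¬ P z) ∨
      ∃ r < S.k, ∃ z, I.edge r y z ∧ D z := by
  -- A single mark must serve the whole trace. If a violated equation is reachable, lead the trace
  -- to one such violation; otherwise the mark plays no role.
  by_cases h : ∃ y, Relation.ReflTransGen (S.Step I) x y ∧ S.EqDefect I y
  · obtain ⟨y, h1, e, he, h2, z, z', h3, h4, h5⟩ := h
    -- The trace consists of all elements from which `y` is reachable, and the mark is the end of
    -- the first path alone.
    refine ⟨fun u => Relation.ReflTransGen (S.Step I) u y, fun u => u = z, h1, fun u hu => ?_⟩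
    rcases Relation.ReflTransGen.cases_head hu with rfl | ⟨w, ⟨r, hr, h6⟩, h7⟩
    · exact .inr (.inl ⟨e, he, h2, ⟨z, h3, rfl⟩, z', h4, fun h => h5 h.symm⟩)
    · exact .inr (.inr ⟨r, hr, w, h6, h7⟩)
  -- An element that is not good and violates no equation satisfies a bad concept or has a successor
  -- that is not good; the trace may thus follow an infinite path.
  · refine ⟨fun u => Relation.ReflTransGen (S.Step I) x u ∧ ¬ S.Good I u, fun _ => True,
      ⟨.refl, hx⟩, ?_⟩
    rintro u ⟨h1, h2⟩
    by_contra! h3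
    refine h2 (.mk u h3.1 (fun h4 => h ⟨u, h1, h4⟩) fun r hr y hy => ?_)
    exact h3.2.2 r hr y hy (h1.tail ⟨r, hr, hy⟩)

/-- The relations of a structure after a change of three concept names. -/
def changedRel (M : Type) [Voc.Structure M] (A D P : M → Prop) :
    (n : ℕ) → Voc.Relations n → (Fin n → M) → Prop
  | _, .mk 0 a, xs => if a = S.posName then A (xs 0) else if a = S.traceName then D (xs 0)
      else if a = S.markName then P (xs 0) else Structure.RelMap (conceptName a) xs
  | _, .mk (n + 1) r, xs => Structure.RelMap (L := Voc) (RelSym.mk (n + 1) r) xs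

/-- The functions of a structure after a change of the constant `0`. -/
def changedFun (M : Type) [Voc.Structure M] (x : M) :
    (n : ℕ) → Voc.Functions n → (Fin n → M) → M
  | _, .const 0, _ => x
  | _, .const (c + 1), _ => constVal M (c + 1)

/-- A change of three concept names and the constant `0`. -/
@[reducible]
def changed (M : Type) [Voc.Structure M] (x : M) (A D P : M → Prop) : Voc.Structure M where
  funMap {n} f xs := changedFun M x n f xs
  RelMap {n} R xs := S.changedRel M A D P n R xs

/-- Contrapositive: without good roots, every model can be altered outside the reach of the formula
so that the positive example sits on the element of the negative one. The formula holds there after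
the change, hence also before it. -/
theorem projectivelySeparable_imp (h : Rewrites L onto (S.rootStatement R :: S.baseOnto))
    (hR : R.Plain S.l S.k) (hsep : (S.input onto).ProjectivelySeparable L) :
    ∃ (V : Type) (I : Interp V) (x : V), S.Functional I ∧ S.Good I x ∧ I.sat R x := by
  by_contra! hno
  obtain ⟨φ, -, hφ⟩ := hsep
  refine hφ.neg ![1] (List.mem_singleton.2 rfl) fun M iM _ hM => ?_
  obtain ⟨hfun, -, -, -, hneg⟩ := (S.isModel_iff h M).1 hM
  set x := constVal M 1
  let I : Interp M := Interp.of M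
  obtain ⟨D, P, hD, hDP⟩ : ∃ D P : M → Prop, (I.sat R x → D x) ∧ ∀ y, D y →
      (∃ C ∈ S.bad, I.sat C y) ∨
      (∃ e ∈ S.eqs, I.sat e.1 y ∧ (∃ z, I.path e.2.1 y z ∧ P z) ∧
        ∃ z, I.path e.2.2 y z ∧ ¬ P z) ∨
      ∃ r < S.k, ∃ z, I.edge r y z ∧ D z := by
    -- A good `x` does not satisfy `R`, so the empty trace will do.
    by_cases hg : S.Good I x
    · exact ⟨fun _ => False, fun _ => False, fun h => hno M I x hfun hg h, fun _ => False.elim⟩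
    · obtain ⟨D, P, h1, h2⟩ := S.exists_trace I x hg
      exact ⟨D, P, fun _ => h1, h2⟩
  let iN : Voc.Structure M := S.changed M x (· = x) D P
  let J : Interp M := @Interp.of M iN
  have hc0 : @constVal M iN 0 = x := rfl
  have hc1 : ∀ c ≠ 0, @constVal M iN c = @constVal M iM c := by
    intro c hc
    obtain ⟨c, rfl⟩ := Nat.exists_eq_succ_of_ne_zero hc
    rfl
  have hlab : ∀ a y, J.lab a y ↔ if a = S.posName then y = x else if a = S.traceName then D y
      else if a = S.markName then P y else I.lab a y := fun a y => Iff.rfl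
  have hedge : ∀ r y z, I.edge r y z ↔ J.edge r y z := fun r y z => Iff.rfl
  -- The changed names have the indices `l`, `l + 1`, `l + 2`, so plain concepts keep their meaning.
  have hlow : ∀ a < S.l, ∀ y, I.lab a y ↔ J.lab a y := by
    intro a ha y
    rw [hlab, if_neg, if_neg, if_neg] <;> simp only [posName, traceName, markName] <;> omega
  have hplain : ∀ {C : Concept}, C.Plain S.l S.k → ∀ y, I.sat C y ↔ J.sat C y :=
    fun hC y => Interp.sat_congr hlow hedge hC y
  have hpath := Interp.path_congr hedge
  have hpos : ∀ y, J.lab S.posName y ↔ y = x := fun y => by rw [hlab, if_pos rfl]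
  have htr : ∀ y, J.lab S.traceName y ↔ D y := fun y => by
    rw [hlab, if_neg, if_pos rfl]
    simp only [posName, traceName]
    omega
  have hmk : ∀ y, J.lab S.markName y ↔ P y := fun y => by
    rw [hlab, if_neg, if_neg, if_pos rfl] <;> simp only [posName, traceName, markName] <;> omega
  have hN : @Input.IsModel (S.input onto) M iN := by
    refine (@isModel_iff S L onto R h M iN _).2 ⟨hfun, ?_, ?_, ?_, ?_⟩
    · intro y hy
      rw [sat_traceConcept]
      rcases hDP y ((htr y).1 hy) with ⟨C, h1, h2⟩ | ⟨e, he, h1, ⟨z, h2, h3⟩, z', h4, h5⟩ |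
        ⟨r, hr, z, h1, h2⟩
      · exact .inl ⟨C, h1, (hplain (S.bad_plain C h1) y).1 h2⟩
      · exact .inr (.inl ⟨e, he, (hplain (S.eqs_plain e he) y).1 h1,
          ⟨z, (hpath _ _ _).1 h2, (hmk z).2 h3⟩, z', (hpath _ _ _).1 h4,
          fun h6 => h5 ((hmk z').1 h6)⟩)
      · exact .inr (.inr ⟨r, hr, z, (hedge _ _ _).1 h1, (htr z).2 h2⟩)
    · intro y h1 h2
      obtain rfl := (hpos y).1 h1
      exact (htr _).2 (hD ((hplain hR _).2 h2))
    · exact (hpos _).2 hc0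
    · rw [hc1 1 one_ne_zero]
      refine (hlab _ _).2 ?_
      rw [if_neg, if_neg, if_neg]
      · exact hneg
      all_goals simp only [posName, traceName, markName, negName]; omega
  have key := @Input.Separates.pos (S.input onto) φ hφ ![0] (List.mem_singleton.2 rfl) M iN _ hN
  have e0 : (fun i : Fin 1 => @constVal M iN ((![0] : Fin 1 → ℕ) i)) = fun _ => x := by
    funext i
    fin_cases i
    rfl
  have e1 : (fun i : Fin 1 => @constVal M iM ((![1] : Fin 1 → ℕ) i)) = fun _ => x := by
    funext i
    fin_cases i
    rfl
  have key' : @Formula.Realize Voc M iN (Fin 1) φ fun _ => x := by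
    rw [← e0]
    exact key
  show @Formula.Realize Voc M iM (Fin 1) φ fun i : Fin 1 => @constVal M iM ((![1] : Fin 1 → ℕ) i)
  rw [e1]
  refine (realize_congr iM iN φ ?_ ?_ _ _).2 key'
  · intro c hc
    refine (hc1 c ?_).symm
    rintro rfl
    exact Set.disjoint_left.1 hφ.consts hc ((S.mem_dbConsts onto 0).2 (.inl rfl))
  · rintro m ⟨n, a⟩ hs xs
    cases n with
    | succ n => rfl
    | zero =>
      -- A symbol of the formula with index between `l` and `l + 2` would belong to the knowledge
      -- base but not to the signature. The index `l + 3` labels the negative example and was not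
      -- changed.
      have hn : a < S.l ∨ S.l + 3 ≤ a := by
        by_contra! hcon
        exact absurd ((S.label_mem_sigSet onto a).1
          (hφ.syms ⟨hs, S.label_mem_kbSyms h hcon.2⟩)) (by omega)
      show _ ↔ if a = S.posName then _ else if a = S.traceName then _ else if a = S.markName then _
        else _
      rw [if_neg, if_neg, if_neg]
      · rfl
      all_goals simp only [posName, traceName, markName]; omega

end DefectSpec

/-! ### Symbols of long conjunctions, and structures built from interpretations -/

theorem Concept.syms_bigConj {T : Set Sym} {l : List Concept} (h0 : Concept.top.syms ⊆ T)
    (h : ∀ C ∈ l, C.syms ⊆ T) : (Concept.bigConj l).syms ⊆ T := by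
  induction l with
  | nil => exact h0
  | cons C l ih =>
    exact Set.union_subset (h C (by simp)) (ih fun D hD => h D (by simp [hD]))

theorem Concept.noms_bigConj {T : Set ℕ} {l : List Concept} (h : ∀ C ∈ l, C.noms ⊆ T) :
    (Concept.bigConj l).noms ⊆ T := by
  induction l with
  | nil => simp [Concept.bigConj, Concept.top, Concept.noms]
  | cons C l ih =>
    exact Set.union_subset (h C (by simp)) (ih fun D hD => h D (by simp [hD]))

/-- The structure with a given interpretation of concept names, role names and constants in which
all other relations are empty. -/
@[reducible]
def Interp.toStructure {V : Type} (I : Interp V) : Voc.Structure V where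
  funMap {n} f _ := match n, f with
    | _, .const c => I.nom c
  RelMap {n} R xs := match n, R, xs with
    | _, .mk 0 a, xs => I.lab a (xs 0)
    | _, .mk 1 r, xs => I.edge r (xs 0) (xs 1)
    | _, .mk (_ + 2) _, _ => False

theorem Interp.of_toStructure {V : Type} (I : Interp V) : @Interp.of V I.toStructure = I := rfl

namespace DefectSpec

variable (S : DefectSpec)

/-! ### Good roots are separated by a description of the part reachable from them -/

/-- `e` starts a copy of the part of `I` that is reachable from `d`, in which each element is named
by a nominal. -/
inductive Copy {V W : Type} [Encodable V] (I : Interp V) (N : Interp W) : W → V → Prop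
  | mk (e : W) (d : V) (f : ℕ → V → W) (nom : e = N.nom (Encodable.encode d + 2))
    (lab : ∀ A < S.l, N.lab A e ↔ I.lab A d)
    (edge : ∀ r < S.k, ∀ d', I.edge r d d' → N.edge r e (f r d'))
    (no_edge : ∀ r < S.k, (∀ d', ¬ I.edge r d d') → ∀ e', ¬ N.edge r e e')
    (succ : ∀ r < S.k, ∀ d', I.edge r d d' → Copy I N (f r d') d') : Copy I N e d

/-- The interpretation in which the root is not a positive example. -/
def separatingInterp {V : Type} [Encodable V] (I : Interp V) (x : V) : Interp (Option V) where
  lab A y := (A < S.l ∧ ∃ d, y = some d ∧ I.lab A d) ∨ (A = S.posName ∧ y = none) ∨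
    (A = S.negName ∧ y = some x)
  edge r y z := ∃ d d', y = some d ∧ z = some d' ∧ I.edge r d d'
  nom c := if c = 0 then none else if c = 1 then some x else Encodable.decode (c - 2)

/-- Being a copy is a bisimulation: since roles are functional in `N`, the prescribed successor is
the only one, and where the original has no successor the copy has none. -/
theorem Copy.bisim {V W : Type} [Encodable V] {I : Interp V} {N : Interp W}
    (hN : S.Functional N) {C : Concept} (hC : C.Plain S.l S.k) {e : W} {d : V}
    (h : S.Copy I N e d) : N.sat C e ↔ I.sat C d := by
  refine Interp.sat_iff_of_bisim (S.Copy I N) ?_ ?_ ?_ hC h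
  · rintro x y ⟨_, _, f, _, h, _⟩
    exact h
  · rintro x y ⟨_, _, f, _, _, h1, h2, h3⟩ r hr x' hx'
    by_cases h : ∃ d', I.edge r y d'
    · obtain ⟨d', hd'⟩ := h
      obtain rfl := hN r hr _ _ _ hx' (h1 r hr d' hd')
      exact ⟨d', hd', h3 r hr d' hd'⟩
    · exact (h2 r hr (not_exists.1 h) x' hx').elim
  · rintro x y ⟨_, _, f, _, _, h1, _, h3⟩ r hr y' hy'
    exact ⟨f r y', h1 r hr y' hy', h3 r hr y' hy'⟩

theorem Copy.path {V W : Type} [Encodable V] {I : Interp V} {N : Interp W}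
    (hN : S.Functional N) {p : List ℕ} (hp : ∀ r ∈ p, r < S.k) {e e' : W} {d : V}
    (h : S.Copy I N e d) (he : N.path p e e') : ∃ d', I.path p d d' ∧ S.Copy I N e' d' := by
  induction p generalizing e d with
  | nil =>
    obtain rfl : e = e' := he
    exact ⟨d, rfl, h⟩
  | cons r p ih =>
    obtain ⟨z, hz, hze⟩ := he
    obtain ⟨_, _, f, _, _, h1, h2, h3⟩ := h
    have hr := hp r (by simp)
    by_cases h : ∃ d', I.edge r d d'
    · obtain ⟨d', hd'⟩ := h
      obtain rfl := hN r hr _ _ _ hz (h1 r hr d' hd')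
      obtain ⟨d'', h4, h5⟩ := ih (fun r hr => hp r (by simp [hr])) (h3 r hr d' hd') hze
      exact ⟨d'', ⟨d', hd', h4⟩, h5⟩
    · exact (h2 r hr (not_exists.1 h) z hz).elim

theorem Copy.eq_nom {V W : Type} [Encodable V] {I : Interp V} {N : Interp W} {e : W} {d : V}
    (h : S.Copy I N e d) : e = N.nom (Encodable.encode d + 2) := by
  obtain ⟨_, _, _, h, _⟩ := h
  exact h

/-- No trace starts in a copy of a good element. -/
theorem Copy.not_trace {V W : Type} [Encodable V] {I : Interp V} {N : Interp W}
    (hN : S.Functional N) (hp : ∀ e ∈ S.eqs, ∀ r ∈ e.2.1 ++ e.2.2, r < S.k)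
    (htr : ∀ x, N.lab S.traceName x → N.sat S.traceConcept x) {d : V} (hd : S.Good I d) :
    ∀ e, S.Copy I N e d → ¬ N.lab S.traceName e := by
  induction hd with
  | mk d bad eqs _ ih =>
    intro e he htrace
    rcases (S.sat_traceConcept N e).1 (htr e htrace) with ⟨C, h1, h2⟩ |
      ⟨q, hq, h1, ⟨y, h2, h3⟩, z, h4, h5⟩ | ⟨r, hr, y, h1, h2⟩
    · exact bad C h1 ((he.bisim S hN (S.bad_plain C h1)).1 h2)
    · obtain ⟨y', h6, h7⟩ := he.path S hN (fun r hr => hp q hq r (by simp [hr])) h2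
      obtain ⟨z', h8, h9⟩ := he.path S hN (fun r hr => hp q hq r (by simp [hr])) h4
      refine eqs ⟨q, hq, (he.bisim S hN (S.eqs_plain q hq)).1 h1, y', z', h6, h8, ?_⟩
      -- If the two paths end in the same element of `I`, both ends in `N` are the denotation of the
      -- same nominal, so the mark cannot tell them apart.
      rintro rfl
      rw [h9.eq_nom, ← h7.eq_nom] at h5
      exact h5 h3
    · obtain ⟨_, _, f, _, _, h3, h4, h5⟩ := he
      by_cases h : ∃ d', I.edge r d d'
      · obtain ⟨d', hd'⟩ := h
        obtain rfl := hN r hr _ _ _ h1 (h3 r hr d' hd')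
        exact ih r hr d' hd' _ (h5 r hr d' hd') h2
      · exact h4 r hr (not_exists.1 h) y h1

/-- The symbols in the signature. -/
def sigSyms : Set Sym :=
  {s | (∃ A < S.l, ⟨1, conceptName A⟩ = s) ∨ ∃ r < S.k, ⟨2, roleName r⟩ = s}

/-- Induction on `Good`: well-foundedness, together with finitely many functional roles, lets
finitely many nested restrictions describe everything reachable. Each element contributes its
nominal, its labels in the signature, and for each role either the description of the successor or
the absence of one. The nominals start at 2 because 0 and 1 are database constants. -/
theorem exists_description {V : Type} [Encodable V] {I : Interp V} (hI : S.Functional I)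
    (hl : 0 < S.l) (x : V) {d : V} (hd : S.Good I d) :
    ∃ T : Concept, T.syms ⊆ S.sigSyms ∧ T.noms ⊆ {c | 2 ≤ c} ∧
      (S.separatingInterp I x).sat T (some d) ∧
      ∀ (W : Type) (N : Interp W) (e : W), N.sat T e → S.Copy I N e d := by
  have htop : Concept.top.syms ⊆ S.sigSyms := by
    simp only [Concept.top, Concept.syms, Set.union_self, Set.singleton_subset_iff]
    exact .inl ⟨0, hl, rfl⟩
  have htop' : Concept.top.noms = ∅ := by simp [Concept.top, Concept.noms]
  induction hd with
  | mk d _ _ _ ih =>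
    have hrole : ∀ r < S.k, ∃ C : Concept, C.syms ⊆ S.sigSyms ∧ C.noms ⊆ {c | 2 ≤ c} ∧
        (S.separatingInterp I x).sat C (some d) ∧
        ∀ (W : Type) (N : Interp W) (e : W), N.sat C e →
          (∀ d', I.edge r d d' → ∃ e', N.edge r e e' ∧ S.Copy I N e' d') ∧
          ((∀ d', ¬ I.edge r d d') → ∀ e', ¬ N.edge r e e') := by
      intro r hr
      have hmem : (⟨2, roleName r⟩ : Sym) ∈ S.sigSyms := .inr ⟨r, hr, rfl⟩
      by_cases h : ∃ d', I.edge r d d'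
      · obtain ⟨d', hd'⟩ := h
        obtain ⟨T, h1, h2, h3, h4⟩ := ih r hr d' hd'
        refine ⟨.dia r T, Set.union_subset (Set.singleton_subset_iff.2 hmem) h1, h2,
          ⟨some d', ⟨d, d', rfl, rfl, hd'⟩, h3⟩, ?_⟩
        rintro W N e ⟨e', h5, h6⟩
        refine ⟨fun d'' hd'' => ?_, fun h => (h d' hd').elim⟩
        obtain rfl := hI r hr _ _ _ hd' hd''
        exact ⟨e', h5, h4 W N e' h6⟩
      · refine ⟨.neg (.dia r .top), Set.union_subset (Set.singleton_subset_iff.2 hmem) htop,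
          ?_, ?_, ?_⟩
        · show Concept.top.noms ⊆ _
          simp [htop']
        · simp only [Interp.sat_neg, Interp.sat_dia, Interp.sat_top, and_true]
          rintro ⟨y, d1, d', h1, -, h2⟩
          obtain rfl : d = d1 := by simpa using h1
          exact h ⟨d', h2⟩
        · intro W N e he
          simp only [Interp.sat_neg, Interp.sat_dia, Interp.sat_top, and_true] at he
          exact ⟨fun d' hd' => (h ⟨d', hd'⟩).elim, fun _ => not_exists.1 he⟩
    have : Nonempty Concept := ⟨.top⟩
    choose! C hC1 hC2 hC3 hC4 using hrole
    classical
    let Λ : ℕ → Concept := fun A => if I.lab A d then .name A else .neg (.name A)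
    refine ⟨.conj (.nominal (Encodable.encode d + 2)) (.conj (.bigConj ((List.range S.l).map Λ))
      (.bigConj ((List.range S.k).map C))), ?_, ?_, ?_, ?_⟩
    · refine Set.union_subset (Set.empty_subset _) (Set.union_subset
        (Concept.syms_bigConj htop ?_) (Concept.syms_bigConj htop ?_)) <;>
      simp only [List.forall_mem_map, List.mem_range]
      · intro A hA
        have : (⟨1, conceptName A⟩ : Sym) ∈ S.sigSyms := .inl ⟨A, hA, rfl⟩
        simp only [Λ]
        split_ifs <;> simpa [Concept.syms] using this
      · exact hC1
    · refine Set.union_subset (by simp [Concept.noms]) (Set.union_subset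
        (Concept.noms_bigConj ?_) (Concept.noms_bigConj ?_)) <;>
      simp only [List.forall_mem_map, List.mem_range]
      · intro A hA
        simp only [Λ]
        split_ifs <;> simp [Concept.noms]
      · exact hC2
    · simp only [Interp.sat_conj, Interp.sat_nominal, Interp.sat_bigConj, List.forall_mem_map,
        List.mem_range]
      refine ⟨by simp [separatingInterp], fun A hA => ?_, hC3⟩
      have : (S.separatingInterp I x).lab A (some d) ↔ I.lab A d := by
        simp only [separatingInterp, posName, negName, Option.some.injEq]
        constructor
        · rintro (⟨-, d', rfl, h⟩ | ⟨-, h⟩ | ⟨h, -⟩)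
          · exact h
          · cases h
          · omega
        · exact fun h => .inl ⟨hA, d, rfl, h⟩
      simp only [Λ]
      split_ifs with h <;> simpa [this] using h
    · intro W N e
      simp only [Interp.sat_conj, Interp.sat_nominal, Interp.sat_bigConj, List.forall_mem_map,
        List.mem_range]
      rintro ⟨h1, h2, h3⟩
      have : Nonempty W := ⟨e⟩
      -- The function `f` in `Copy` is total; where there is no edge, `e` is a dummy value.
      have h4 : ∀ r d', ∃ e', r < S.k → I.edge r d d' → N.edge r e e' ∧ S.Copy I N e' d' := by
        intro r d'
        by_cases h : r < S.k ∧ I.edge r d d'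
        · obtain ⟨e', he'⟩ := (hC4 r h.1 W N e (h3 r h.1)).1 d' h.2
          exact ⟨e', fun _ _ => he'⟩
        · exact ⟨e, fun h1 h2 => (h ⟨h1, h2⟩).elim⟩
      choose f hf using h4
      refine .mk e d f h1 (fun A hA => ?_) (fun r hr d' hd' => (hf r d' hr hd').1)
        (fun r hr => (hC4 r hr W N e (h3 r hr)).2) (fun r hr d' hd' => (hf r d' hr hd').2)
      have := h2 A hA
      simp only [Λ] at this
      split_ifs at this with h <;> simpa [h] using this

variable {L : Fragment} {onto : List Voc.Sentence}

theorem separable_of_good (hL : L.Contains ALCFIO) {a : ℕ} {R : Concept}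
    (h : Rewrites L onto (S.rootStatement (.conj (.name a) R) :: S.baseOnto)) (ha : a < S.l)
    (hR : R.Plain S.l S.k) (hp : ∀ e ∈ S.eqs, ∀ r ∈ e.2.1 ++ e.2.2, r < S.k)
    {V : Type} [Encodable V] {I : Interp V} (hI : S.Functional I) {x : V} (hx : S.Good I x)
    (hxR : I.sat (.conj (.name a) R) x) : (S.input onto).Separable L := by
  obtain ⟨T, h1, h2, h3, h4⟩ := S.exists_description hI (by omega) x hx
  obtain ⟨φ, hφ, heq, hsym, hcon⟩ := hL.2.2.2 1 _ ⟨.neg T, rfl⟩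
  have hreal : ∀ (M : Type) [Voc.Structure M] [Nonempty M] (c : ℕ),
      (φ.Realize fun i => constVal M ((![c] : Fin 1 → ℕ) i)) ↔
        ¬ (Interp.of M).sat T (constVal M c) := by
    intro M _ _ c
    rw [heq M]
    exact realize_concept (.neg T) _ _ _
  have hsig : relSyms φ ⊆ (S.input onto).sigSet := by
    intro s hs
    rw [hsym] at hs
    rw [mem_sigSet]
    exact h1 ((relSyms_concept (.neg T) _).subset hs)
  refine ⟨φ, hφ, ⟨fun s hs => hsig hs.1, ?_, ?_, ?_⟩, hsig⟩
  · refine Set.disjoint_left.2 fun c hc hc' => ?_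
    have h5 : c ∈ consts φ := hc
    rw [hcon] at h5
    have h6 : 2 ≤ c := h2 ((consts_concept (.neg T) _).subset h5)
    rw [mem_dbConsts] at hc'
    omega
  · intro c hc M _ _ hM
    obtain rfl : c = ![0] := List.mem_singleton.1 hc
    refine (hreal M 0).2 fun hT => ?_
    obtain ⟨h5, h6, h7, h8, -⟩ := (S.isModel_iff h M).1 hM
    have hcopy := h4 M _ _ hT
    have hplain : (Concept.conj (.name a) R).Plain S.l S.k := ⟨ha, hR⟩
    exact hcopy.not_trace S h5 hp h6 hx _ (h7 _ h8 ((hcopy.bisim S h5 hplain).2 hxR))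
  · intro c hc hent
    obtain rfl : c = ![1] := List.mem_singleton.1 hc
    -- Here `T` holds at the negative example `some x`. The positive example is the extra element
    -- `none`; it lacks the label `a` and so is no root, and the trace may be empty.
    let iM := (S.separatingInterp I x).toStructure
    have hM : @Input.IsModel (S.input onto) (Option V) iM := by
      rw [S.isModel_iff h (Option V), Interp.of_toStructure]
      refine ⟨?_, ?_, ?_, ?_, ?_⟩
      · rintro r hr _ _ _ ⟨d, d', rfl, rfl, h5⟩ ⟨d1, d'', h6, rfl, h7⟩
        obtain rfl : d = d1 := by simpa using h6
        rw [hI r hr _ _ _ h5 h7]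
      · rintro y (⟨h5, -⟩ | ⟨h5, -⟩ | ⟨h5, -⟩) <;>
        simp only [traceName, posName, negName] at h5 <;> omega
      · rintro y (⟨h5, -⟩ | ⟨-, rfl⟩ | ⟨h5, -⟩) ⟨h6, -⟩
        · simp only [posName] at h5
          omega
        · rcases h6 with ⟨-, d, h6, -⟩ | ⟨h6, -⟩ | ⟨h6, -⟩
          · cases h6
          · simp only [posName] at h6
            omega
          · simp only [negName] at h6
            omega
        · simp only [posName, negName] at h5
          omega
      · exact .inr (.inl ⟨rfl, rfl⟩)
      · exact .inr (.inr ⟨rfl, rfl⟩)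
    exact (hreal (Option V) 1).1 (hent (Option V) hM) h3

end DefectSpec

/-! ### Evaluation of partial recursive functions as a defect-free graph -/

namespace EvalGraph

open Turing.ToPartrec (Code)
open Separability.Concept

theorem mem_eval_cons {f fs : Code} {v w : List ℕ} :
    w ∈ (Code.cons f fs).eval v ↔ ∃ a ∈ f.eval v, ∃ b ∈ fs.eval v, w = a.headI :: b := by
  simp [Code.cons_eval, Part.bind_eq_bind]

theorem mem_eval_comp {f g : Code} {v w : List ℕ} :
    w ∈ (Code.comp f g).eval v ↔ ∃ u ∈ g.eval v, w ∈ f.eval u := by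
  rw [Code.comp_eval]
  exact Part.mem_bind_iff

theorem mem_eval_fix {f : Code} {v w : List ℕ} : w ∈ (Code.fix f).eval v ↔
    ∃ u ∈ f.eval v, (u.headI = 0 ∧ w = u.tail) ∨ (u.headI ≠ 0 ∧ w ∈ (Code.fix f).eval u.tail) := by
  rw [Code.fix_eval]
  refine PFun.mem_fix_iff.trans ?_
  simp only [Part.mem_map_iff]
  constructor
  · rintro (⟨u, hu, h⟩ | ⟨a, ⟨u, hu, h⟩, hw⟩)
    · split_ifs at h with h0
      · exact ⟨u, hu, .inl ⟨h0, (Sum.inl.inj h).symm⟩⟩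
    · split_ifs at h with h0
      · obtain rfl := Sum.inr.inj h
        exact ⟨u, hu, .inr ⟨h0, hw⟩⟩
  · rintro ⟨u, hu, ⟨h0, rfl⟩ | ⟨h0, hw⟩⟩
    · exact .inl ⟨u, hu, by rw [if_pos h0]⟩
    · exact .inr ⟨u.tail, ⟨u, hu, by rw [if_neg h0]⟩, hw⟩

theorem mem_eval_case_zero {f g : Code} {v w : List ℕ} (h : v.headI = 0) :
    w ∈ (Code.case f g).eval v ↔ w ∈ f.eval v.tail := by
  simp [Code.case_eval, h]

theorem mem_eval_case_succ {f g : Code} {v w : List ℕ} {n : ℕ} (h : v.headI = n + 1) :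
    w ∈ (Code.case f g).eval v ↔ w ∈ g.eval (n :: v.tail) := by
  simp [Code.case_eval, h]

/-! ### Numbering of codes, and their subcodes -/

/-- A number for each code. -/
def num : Code → ℕ
  | .zero' => Nat.pair 0 0
  | .succ => Nat.pair 1 0
  | .tail => Nat.pair 2 0
  | .cons f g => Nat.pair 3 (Nat.pair (num f) (num g))
  | .comp f g => Nat.pair 4 (Nat.pair (num f) (num g))
  | .case f g => Nat.pair 5 (Nat.pair (num f) (num g))
  | .fix f => Nat.pair 6 (num f)

theorem num_injective : Function.Injective num := by
  intro c
  induction c with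
  | zero' => intro d h; cases d <;> simp [num, Nat.pair_eq_pair] at h ⊢
  | succ => intro d h; cases d <;> simp [num, Nat.pair_eq_pair] at h ⊢
  | tail => intro d h; cases d <;> simp [num, Nat.pair_eq_pair] at h ⊢
  | cons f g ihf ihg =>
    intro d h; cases d <;> simp [num, Nat.pair_eq_pair] at h ⊢
    exact ⟨ihf h.1, ihg h.2⟩
  | comp f g ihf ihg =>
    intro d h; cases d <;> simp [num, Nat.pair_eq_pair] at h ⊢
    exact ⟨ihf h.1, ihg h.2⟩
  | case f g ihf ihg =>
    intro d h; cases d <;> simp [num, Nat.pair_eq_pair] at h ⊢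
    exact ⟨ihf h.1, ihg h.2⟩
  | fix f ihf =>
    intro d h; cases d <;> simp [num, Nat.pair_eq_pair] at h ⊢
    exact ihf h

instance : Countable Code := num_injective.countable

/-- The subcodes of a code. -/
def subs : Code → List Code
  | .zero' => [.zero']
  | .succ => [.succ]
  | .tail => [.tail]
  | .cons f g => .cons f g :: (subs f ++ subs g)
  | .comp f g => .comp f g :: (subs f ++ subs g)
  | .case f g => .case f g :: (subs f ++ subs g)
  | .fix f => .fix f :: subs f

theorem self_mem_subs (c : Code) : c ∈ subs c := by
  cases c <;> simp [subs]

theorem subs_subset {c d : Code} (h : d ∈ subs c) : subs d ⊆ subs c := by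
  induction c with
  | zero' => simp [subs] at h; subst h; simp
  | succ => simp [subs] at h; subst h; simp
  | tail => simp [subs] at h; subst h; simp
  | cons f g ihf ihg =>
    simp only [subs, List.mem_cons, List.mem_append] at h
    rcases h with rfl | h | h
    · simp
    · exact fun x hx => by simp [subs, ihf h hx]
    · exact fun x hx => by simp [subs, ihg h hx]
  | comp f g ihf ihg =>
    simp only [subs, List.mem_cons, List.mem_append] at h
    rcases h with rfl | h | h
    · simp
    · exact fun x hx => by simp [subs, ihf h hx]
    · exact fun x hx => by simp [subs, ihg h hx]
  | case f g ihf ihg =>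
    simp only [subs, List.mem_cons, List.mem_append] at h
    rcases h with rfl | h | h
    · simp
    · exact fun x hx => by simp [subs, ihf h hx]
    · exact fun x hx => by simp [subs, ihg h hx]
  | fix f ihf =>
    simp only [subs, List.mem_cons] at h
    rcases h with rfl | h
    · simp
    · exact fun x hx => by simp [subs, ihf h hx]

/-! Numbers are chains of the role `pred`; lists are chains of the role `tail` with the entries
attached by `head`. An evaluation has an input, an output, and at most two subevaluations. -/

/-- from a number to its predecessor -/
abbrev pred : ℕ := 0
/-- from a list to its first entry -/
abbrev head : ℕ := 1
/-- from a list to its tail -/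
abbrev tail : ℕ := 2
/-- from an evaluation to its input -/
abbrev inp : ℕ := 3
/-- from an evaluation to its output -/
abbrev out : ℕ := 4
/-- from an evaluation to its first subevaluation -/
abbrev fst : ℕ := 5
/-- from an evaluation to its second subevaluation -/
abbrev snd : ℕ := 6

/-- being zero -/
def isZero : Concept := .neg (dia pred top)
/-- being a non-empty list -/
def nonempty : Concept := dia tail top
/-- being a list with a positive first entry -/
def positive : Concept := .conj nonempty (dia head (dia pred top))
/-- being an evaluation of a code -/
def label (c : Code) : Concept := .name (num c)

/-- What evaluations of a code have to satisfy, apart from path equations. -/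
def req : Code → Concept
  | .zero' => .conj (dia inp top) (dia out (.conj nonempty (dia head isZero)))
  | .succ => .conj (dia inp top)
      (.conj (dia out (.conj (dia tail (.neg nonempty)) (dia head (dia pred top))))
        (disj (dia inp nonempty) (dia out (dia head (dia pred isZero)))))
  | .tail => .conj (dia inp top) (.conj (dia out top)
      (disj (dia inp nonempty) (dia out (.neg nonempty))))
  | .cons f fs => .conj (dia inp top) (.conj (dia out (.conj nonempty (dia head top)))
      (.conj (dia fst (label f)) (.conj (dia snd (label fs))
        (disj (dia fst (dia out nonempty)) (dia out (dia head isZero))))))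
  | .comp f g => .conj (dia inp top) (.conj (dia out top)
      (.conj (dia fst (label g)) (dia snd (label f))))
  | .case f g => .conj (dia inp top) (.conj (dia out top) (disj
      (.conj (dia inp positive)
        (dia snd (.conj (label g) (dia inp (.conj nonempty (dia head top))))))
      (.conj (.neg (dia inp positive)) (.conj (dia fst (label f))
        (disj (dia inp nonempty) (dia fst (dia inp (.neg nonempty))))))))
  | .fix f => .conj (dia inp top) (.conj (dia out top) (.conj (dia fst (label f)) (disj
      (.conj (dia fst (dia out positive)) (dia snd (label (.fix f))))
      (.conj (.neg (dia fst (dia out positive)))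
        (disj (dia fst (dia out nonempty)) (dia out (.neg nonempty)))))))

/-- The path equations for evaluations of a code. -/
def eqs (c : Code) : List (Concept × List ℕ × List ℕ) :=
  match c with
  | .zero' => [(label c, [out, tail], [inp])]
  | .succ => [(label c, [out, head, pred], [inp, head])]
  | .tail => [(label c, [out], [inp, tail])]
  | .cons _ _ => [(label c, [fst, inp], [inp]), (label c, [snd, inp], [inp]),
      (label c, [out, tail], [snd, out]), (label c, [out, head], [fst, out, head])]
  | .comp _ _ => [(label c, [fst, inp], [inp]), (label c, [snd, inp], [fst, out]),
      (label c, [out], [snd, out])]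
  | .case _ _ => [(label c, [fst, inp], [inp, tail]), (label c, [snd, inp, head], [inp, head, pred]),
      (label c, [snd, inp, tail], [inp, tail]), (label c, [out], [fst, out]),
      (label c, [out], [snd, out])]
  | .fix _ => [(label c, [fst, inp], [inp]), (label c, [snd, inp], [fst, out, tail]),
      (label c, [out], [snd, out]),
      (.conj (label c) (.neg (dia fst (dia out positive))), [out], [fst, out, tail])]

theorem eqs_fst {c : Code} {e : Concept × List ℕ × List ℕ} (h : e ∈ eqs c) :
    e.1 = label c ∨ e.1 = .conj (label c) (.neg (dia fst (dia out positive))) := by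
  cases c <;> simp only [eqs, List.mem_cons, List.not_mem_nil, or_false] at h <;> aesop

theorem eqs_lt {c : Code} {e : Concept × List ℕ × List ℕ} (h : e ∈ eqs c) :
    ∀ r ∈ e.2.1 ++ e.2.2, r < 7 := by
  revert e
  cases c <;> simp [eqs, pred, head, tail, inp, out, fst, snd] <;> grind

/-- A bound for the labels of the subcodes of a code. -/
def bound (c : Code) : ℕ := ((subs c).map num).sum + 1

theorem num_lt_bound {c d : Code} (h : d ∈ subs c) : num d < bound c :=
  Nat.lt_succ_of_le (List.single_le_sum (fun _ _ => Nat.zero_le _) _ (List.mem_map_of_mem h))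

theorem req_plain {c d : Code} (h : d ∈ subs c) : (req d).Plain (bound c) 7 := by
  have h1 : ∀ e ∈ subs d, num e < bound c := fun e he => num_lt_bound (subs_subset h he)
  have h2 : 0 < bound c := Nat.succ_pos _
  cases d <;>
  simp only [req, Plain, dia, disj, isZero, nonempty, positive, label, top, h2, pred, head, tail, inp,
    out, fst, snd, Nat.reduceLT, and_self, true_and, and_true]
  all_goals refine ⟨h1 _ ?_, h1 _ ?_⟩ <;> simp [subs, self_mem_subs]

/-- The defects of graphs that are meant to describe evaluations of a code. -/
def spec (c : Code) : DefectSpec where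
  l := bound c
  k := 7
  bad := (subs c).map fun d => .conj (label d) (.neg (req d))
  eqs := (subs c).flatMap eqs
  bad_plain := by
    simp only [List.forall_mem_map]
    exact fun d hd => ⟨num_lt_bound hd, req_plain hd⟩
  eqs_plain := by
    simp only [List.mem_flatMap]
    rintro e ⟨d, hd, he⟩
    have h1 : num d < bound c := num_lt_bound hd
    have h2 : 0 < bound c := Nat.succ_pos _
    rcases eqs_fst he with h | h <;> rw [h] <;>
    simp [Plain, dia, nonempty, positive, label, top, h1, h2, pred, head, tail, out, fst]

theorem spec_eqs_lt (c : Code) : ∀ e ∈ (spec c).eqs, ∀ r ∈ e.2.1 ++ e.2.2, r < (spec c).k := by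
  intro e he
  obtain ⟨d, -, h⟩ := List.mem_flatMap.1 he
  exact eqs_lt h

/-! ### Soundness -/

variable {V : Type} {I : Interp V}

/-- An element represents a number. -/
inductive Num (I : Interp V) : V → ℕ → Prop
  | zero (x : V) (h : ∀ y, ¬ I.edge pred x y) : Num I x 0
  | succ (x y : V) (n : ℕ) (h : I.edge pred x y) (hy : Num I y n) : Num I x (n + 1)

/-- An element represents a list. -/
inductive Lst (I : Interp V) : V → List ℕ → Prop
  | nil (x : V) (h : ∀ y, ¬ I.edge tail x y) : Lst I x []
  | cons (x y z : V) (n : ℕ) (v : List ℕ) (hh : I.edge head x y) (hn : Num I y n)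
      (ht : I.edge tail x z) (hv : Lst I z v) : Lst I x (n :: v)

section

variable {c : Code} (hf : (spec c).Functional I)
include hf

theorem edge_unique {r : ℕ} (hr : r < 7) {x y z : V} (h : I.edge r x y) (h' : I.edge r x z) :
    y = z := hf r hr x y z h h'

theorem Num.pred_of_edge {x y : V} {n : ℕ} (h : Num I x n) (hy : I.edge pred x y) :
    ∃ m, n = m + 1 ∧ Num I y m := by
  cases h with
  | zero _ h => exact (h y hy).elim
  | succ _ z m hz h =>
    obtain rfl := edge_unique hf (by decide) hy hz
    exact ⟨m, rfl, h⟩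

theorem Lst.tail_of_edge {x y : V} {v : List ℕ} (h : Lst I x v) (hy : I.edge tail x y) :
    Lst I y v.tail := by
  cases h with
  | nil _ h => exact (h y hy).elim
  | cons _ _ z _ _ _ _ hz h =>
    obtain rfl := edge_unique hf (by decide) hy hz
    exact h

omit hf in
theorem Lst.head_of_edge {x y : V} {v : List ℕ} (h : Lst I x v) (hy : I.edge tail x y) :
    ∃ z, I.edge head x z ∧ Num I z v.headI := by
  cases h with
  | nil _ h => exact (h y hy).elim
  | cons _ z _ _ _ hz h => exact ⟨z, hz, h⟩

omit hf in
theorem Lst.eq_nil {x : V} {v : List ℕ} (h : Lst I x v) (hx : ¬ I.sat nonempty x) : v = [] := by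
  cases h with
  | nil => rfl
  | cons _ _ z _ _ _ _ hz _ => exact (hx ⟨z, hz, by simp⟩).elim

theorem Lst.positive_iff {x : V} {v : List ℕ} (h : Lst I x v) :
    I.sat positive x ↔ v.headI ≠ 0 := by
  constructor
  · rintro ⟨⟨t, ht, -⟩, z, hz, y, hy, -⟩
    obtain ⟨z', hz', hn⟩ := h.head_of_edge ht
    obtain rfl := edge_unique hf (by decide) hz hz'
    obtain ⟨m, hm, -⟩ := hn.pred_of_edge hf hy
    omega
  · intro h0
    cases h with
    | nil => exact (h0 rfl).elim
    | cons _ y z n v hh hn ht hv =>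
      cases hn with
      | zero => exact (h0 rfl).elim
      | succ _ y' n h hn => exact ⟨⟨z, ht, by simp⟩, y, hh, y', h, by simp⟩

omit hf in
theorem Num.of_isZero {x : V} (h : I.sat isZero x) : Num I x 0 :=
  .zero x fun y hy => h ⟨y, hy, by simp⟩

omit hf in
theorem Lst.of_not_nonempty {x : V} (h : ¬ I.sat nonempty x) : Lst I x [] :=
  .nil x fun y hy => h ⟨y, hy, by simp⟩

omit hf in
theorem path_eq {d : V} {b : Code} (hb : b ∈ subs c) (hd : ¬ (spec c).EqDefect I d)
    {e : Concept × List ℕ × List ℕ} (he : e ∈ eqs b) (hsat : I.sat e.1 d) {y z : V}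
    (hy : I.path e.2.1 d y) (hz : I.path e.2.2 d z) : y = z := by
  by_contra hne
  exact hd ⟨e, List.mem_flatMap.2 ⟨b, hb, he⟩, hsat, y, z, hy, hz, hne⟩

/-- Evaluations in good graphs are correct. -/
theorem sound {d : V} (hd : (spec c).Good I d) : ∀ b ∈ subs c, I.lab (num b) d →
    ∃ i o, I.edge inp d i ∧ I.edge out d o ∧
      ∀ v, Lst I i v → ∃ w, Lst I o w ∧ w ∈ b.eval v := by
  induction hd with
  -- The induction runs along the edges of the good graph and not along the code.
  | mk d bad hdef _ ih =>
    intro b hb hlab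
    have hreq : I.sat (req b) d := by
      by_contra h
      exact bad _ (List.mem_map.2 ⟨b, hb, rfl⟩) ⟨hlab, h⟩
    have heq : ∀ p q, (label b, p, q) ∈ eqs b → ∀ {y z}, I.path p d y → I.path q d z → y = z :=
      fun p q h _ _ => path_eq hb hdef h hlab
    have hsub : ∀ {r : ℕ}, r < 7 → ∀ {s : V}, I.edge r d s → ∀ f : Code, f ∈ subs b →
        I.lab (num f) s → ∃ i o, I.edge inp s i ∧ I.edge out s o ∧
          ∀ v, Lst I i v → ∃ w, Lst I o w ∧ w ∈ f.eval v :=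
      fun hr s hs f hf => ih _ hr s hs f (subs_subset hb hf)
    cases b with
    | zero' =>
      obtain ⟨⟨i, hi, -⟩, o, ho, ⟨t, ht, -⟩, h, hh, hz⟩ := hreq
      refine ⟨i, o, hi, ho, fun v hv => ⟨0 :: v, ?_, by simp⟩⟩
      obtain rfl := heq [out, tail] [inp] (by simp [eqs]) ⟨o, ho, t, ht, rfl⟩ ⟨i, hi, rfl⟩
      exact .cons o h t 0 v hh (.of_isZero hz) ht hv
    | succ =>
      simp only [req, Interp.sat_conj, Interp.sat_disj, Interp.sat_dia, Interp.sat_top,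
        and_true, Interp.sat_neg] at hreq
      obtain ⟨⟨i, hi⟩, ⟨o, ho, ⟨t, ht, htn⟩, h, hh, p, hp⟩, hcase⟩ := hreq
      refine ⟨i, o, hi, ho, fun v hv => ⟨[v.headI.succ], ?_, by simp⟩⟩
      refine .cons o h t _ _ hh (.succ h p _ hp ?_) ht (.of_not_nonempty htn)
      -- A path equation says nothing if one of its paths does not exist. On the empty list, where
      -- `headI` is 0 by default, the disjunction in `req` prescribes the value instead; the other
      -- codes treat empty lists in the same way.
      by_cases hn : I.sat nonempty i
      · obtain ⟨t', ht', -⟩ := hn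
        obtain ⟨z, hz, hnum⟩ := hv.head_of_edge ht'
        obtain rfl := heq [out, head, pred] [inp, head] (by simp [eqs])
          ⟨o, ho, h, hh, p, hp, rfl⟩ ⟨i, hi, z, hz, rfl⟩
        exact hnum
      · obtain rfl := hv.eq_nil hn
        rcases hcase with ⟨i', hi', hn'⟩ | ⟨o', ho', h', hh', p', hp', hz⟩
        · obtain rfl := edge_unique hf (by decide) hi hi'
          exact (hn hn').elim
        · obtain rfl := edge_unique hf (by decide) ho ho'
          obtain rfl := edge_unique hf (by decide) hh hh'
          obtain rfl := edge_unique hf (by decide) hp hp'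
          exact .of_isZero hz
    | tail =>
      simp only [req, Interp.sat_conj, Interp.sat_disj, Interp.sat_dia, Interp.sat_top,
        and_true, Interp.sat_neg] at hreq
      obtain ⟨⟨i, hi⟩, ⟨o, ho⟩, hcase⟩ := hreq
      refine ⟨i, o, hi, ho, fun v hv => ⟨v.tail, ?_, by simp⟩⟩
      by_cases hn : I.sat nonempty i
      · obtain ⟨t, ht, -⟩ := hn
        obtain rfl := heq [out] [inp, tail] (by simp [eqs]) ⟨o, ho, rfl⟩ ⟨i, hi, t, ht, rfl⟩
        exact hv.tail_of_edge hf ht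
      · obtain rfl := hv.eq_nil hn
        rcases hcase with ⟨i', hi', hn'⟩ | ⟨o', ho', ho''⟩
        · obtain rfl := edge_unique hf (by decide) hi hi'
          exact (hn hn').elim
        · obtain rfl := edge_unique hf (by decide) ho ho'
          exact .of_not_nonempty ho''
    | cons f fs =>
      simp only [req, Interp.sat_conj, Interp.sat_disj, Interp.sat_dia, Interp.sat_top,
        and_true] at hreq
      obtain ⟨⟨i, hi⟩, ⟨o, ho, ⟨t, ht, -⟩, h, hh⟩, ⟨s, hs, hsl⟩, ⟨s', hs', hsl'⟩, hcase⟩ := hreq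
      obtain ⟨i1, o1, hi1, ho1, h1⟩ := hsub (by decide) hs f (by simp [subs, self_mem_subs]) hsl
      obtain ⟨i2, o2, hi2, ho2, h2⟩ := hsub (by decide) hs' fs (by simp [subs, self_mem_subs]) hsl'
      obtain rfl := heq [fst, inp] [inp] (by simp [eqs]) ⟨s, hs, i1, hi1, rfl⟩ ⟨i, hi, rfl⟩
      obtain rfl := heq [snd, inp] [inp] (by simp [eqs]) ⟨s', hs', i2, hi2, rfl⟩ ⟨_, hi, rfl⟩
      obtain rfl := heq [out, tail] [snd, out] (by simp [eqs]) ⟨o, ho, t, ht, rfl⟩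
        ⟨s', hs', o2, ho2, rfl⟩
      refine ⟨_, o, hi, ho, fun v hv => ?_⟩
      obtain ⟨w1, hw1, he1⟩ := h1 v hv
      obtain ⟨w2, hw2, he2⟩ := h2 v hv
      refine ⟨w1.headI :: w2, .cons o h t _ _ hh ?_ ht hw2,
        mem_eval_cons.2 ⟨w1, he1, w2, he2, rfl⟩⟩
      by_cases hn : I.sat nonempty o1
      · obtain ⟨t', ht', -⟩ := hn
        obtain ⟨z, hz, hnum⟩ := hw1.head_of_edge ht'
        obtain rfl := heq [out, head] [fst, out, head] (by simp [eqs])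
          ⟨o, ho, h, hh, rfl⟩ ⟨s, hs, o1, ho1, z, hz, rfl⟩
        exact hnum
      · obtain rfl := hw1.eq_nil hn
        rcases hcase with ⟨s3, hs3, o3, ho3, hn'⟩ | ⟨o', ho', h', hh', hz⟩
        · obtain rfl := edge_unique hf (by decide) hs hs3
          obtain rfl := edge_unique hf (by decide) ho1 ho3
          exact (hn hn').elim
        · obtain rfl := edge_unique hf (by decide) ho ho'
          obtain rfl := edge_unique hf (by decide) hh hh'
          exact .of_isZero hz
    | comp f g =>
      simp only [req, Interp.sat_conj, Interp.sat_dia, Interp.sat_top, and_true] at hreq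
      obtain ⟨⟨i, hi⟩, ⟨o, ho⟩, ⟨s, hs, hsl⟩, s', hs', hsl'⟩ := hreq
      obtain ⟨i1, o1, hi1, ho1, h1⟩ := hsub (by decide) hs g (by simp [subs, self_mem_subs]) hsl
      obtain ⟨i2, o2, hi2, ho2, h2⟩ := hsub (by decide) hs' f (by simp [subs, self_mem_subs]) hsl'
      obtain rfl := heq [fst, inp] [inp] (by simp [eqs]) ⟨s, hs, i1, hi1, rfl⟩ ⟨i, hi, rfl⟩
      obtain rfl := heq [snd, inp] [fst, out] (by simp [eqs]) ⟨s', hs', i2, hi2, rfl⟩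
        ⟨s, hs, o1, ho1, rfl⟩
      obtain rfl := heq [out] [snd, out] (by simp [eqs]) ⟨o, ho, rfl⟩ ⟨s', hs', o2, ho2, rfl⟩
      refine ⟨_, _, hi, ho, fun v hv => ?_⟩
      obtain ⟨w1, hw1, he1⟩ := h1 v hv
      obtain ⟨w2, hw2, he2⟩ := h2 w1 hw1
      exact ⟨w2, hw2, mem_eval_comp.2 ⟨w1, he1, he2⟩⟩
    | case f g =>
      simp only [req, Interp.sat_conj, Interp.sat_disj, Interp.sat_dia, Interp.sat_top,
        and_true, Interp.sat_neg] at hreq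
      obtain ⟨⟨i, hi⟩, ⟨o, ho⟩, hcase⟩ := hreq
      refine ⟨i, o, hi, ho, fun v hv => ?_⟩
      rcases hcase with ⟨⟨i', hi', hpos⟩, s, hs, hsl, i2, hi2, ⟨t2, ht2, -⟩, h2, hh2⟩ |
        ⟨hpos, ⟨s, hs, hsl⟩, hcase⟩
      · obtain rfl := edge_unique hf (by decide) hi hi'
        obtain ⟨⟨t, ht, -⟩, h, hh, p, hp, -⟩ := hpos
        obtain ⟨i3, o1, hi3, ho1, h1⟩ := hsub (by decide) hs g (by simp [subs, self_mem_subs]) hsl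
        obtain rfl := edge_unique hf (by decide) hi2 hi3
        obtain rfl := heq [out] [snd, out] (by simp [eqs]) ⟨o, ho, rfl⟩ ⟨s, hs, o1, ho1, rfl⟩
        obtain rfl := heq [snd, inp, head] [inp, head, pred] (by simp [eqs])
          ⟨s, hs, i2, hi2, h2, hh2, rfl⟩ ⟨i, hi, h, hh, p, hp, rfl⟩
        obtain rfl := heq [snd, inp, tail] [inp, tail] (by simp [eqs])
          ⟨s, hs, i2, hi2, t2, ht2, rfl⟩ ⟨i, hi, t, ht, rfl⟩
        obtain ⟨h', hh', hnum⟩ := hv.head_of_edge ht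
        obtain rfl := edge_unique hf (by decide) hh hh'
        -- In the successor branch the input of the subevaluation is the old one with the head
        -- replaced by its predecessor, which the equations enforce entry by entry.
        obtain ⟨m, hm, hm'⟩ := hnum.pred_of_edge hf hp
        obtain ⟨w, hw, he⟩ := h1 (m :: v.tail) (.cons i2 h2 t2 m _ hh2 hm' ht2
          (hv.tail_of_edge hf ht))
        exact ⟨w, hw, (mem_eval_case_succ hm).2 he⟩
      · obtain ⟨i1, o1, hi1, ho1, h1⟩ := hsub (by decide) hs f (by simp [subs, self_mem_subs]) hsl
        obtain rfl := heq [out] [fst, out] (by simp [eqs]) ⟨o, ho, rfl⟩ ⟨s, hs, o1, ho1, rfl⟩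
        have h0 : v.headI = 0 := by
          by_contra h0
          exact hpos ⟨i, hi, (hv.positive_iff hf).2 h0⟩
        suffices h : Lst I i1 v.tail by
          obtain ⟨w, hw, he⟩ := h1 _ h
          exact ⟨w, hw, (mem_eval_case_zero h0).2 he⟩
        by_cases hn : I.sat nonempty i
        · obtain ⟨t, ht, -⟩ := hn
          obtain rfl := heq [fst, inp] [inp, tail] (by simp [eqs]) ⟨s, hs, i1, hi1, rfl⟩
            ⟨i, hi, t, ht, rfl⟩
          exact hv.tail_of_edge hf ht
        · obtain rfl := hv.eq_nil hn
          rcases hcase with ⟨i', hi', hn'⟩ | ⟨s', hs', i', hi', hn'⟩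
          · obtain rfl := edge_unique hf (by decide) hi hi'
            exact (hn hn').elim
          · obtain rfl := edge_unique hf (by decide) hs hs'
            obtain rfl := edge_unique hf (by decide) hi1 hi'
            exact .of_not_nonempty hn'
    | fix f =>
      simp only [req, Interp.sat_conj, Interp.sat_disj, Interp.sat_dia, Interp.sat_top,
        and_true, Interp.sat_neg] at hreq
      obtain ⟨⟨i, hi⟩, ⟨o, ho⟩, ⟨s, hs, hsl⟩, hcase⟩ := hreq
      obtain ⟨i1, o1, hi1, ho1, h1⟩ := hsub (by decide) hs f (by simp [subs, self_mem_subs]) hsl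
      obtain rfl := heq [fst, inp] [inp] (by simp [eqs]) ⟨s, hs, i1, hi1, rfl⟩ ⟨i, hi, rfl⟩
      refine ⟨i1, o, hi, ho, fun v hv => ?_⟩
      obtain ⟨u, hu, he⟩ := h1 v hv
      rcases hcase with ⟨⟨s3, hs3, o3, ho3, hpos⟩, s', hs', hsl'⟩ | ⟨hpos, hcase⟩
      · obtain rfl := edge_unique hf (by decide) hs hs3
        obtain rfl := edge_unique hf (by decide) ho1 ho3
        have h0 := (hu.positive_iff hf).1 hpos
        obtain ⟨⟨t, ht, -⟩, -⟩ := hpos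
        -- The next iteration carries the same code, which is why the induction has to be on `Good`.
        obtain ⟨i2, o2, hi2, ho2, h2⟩ := hsub (by decide) hs' (.fix f) (self_mem_subs _) hsl'
        obtain rfl := heq [snd, inp] [fst, out, tail] (by simp [eqs]) ⟨s', hs', i2, hi2, rfl⟩
          ⟨s, hs, o1, ho1, t, ht, rfl⟩
        obtain rfl := heq [out] [snd, out] (by simp [eqs]) ⟨o, ho, rfl⟩ ⟨s', hs', o2, ho2, rfl⟩
        obtain ⟨w, hw, he2⟩ := h2 _ (hu.tail_of_edge hf ht)
        exact ⟨w, hw, mem_eval_fix.2 ⟨u, he, .inr ⟨h0, he2⟩⟩⟩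
      · have h0 : u.headI = 0 := by
          by_contra h0
          exact hpos ⟨s, hs, o1, ho1, (hu.positive_iff hf).2 h0⟩
        refine ⟨u.tail, ?_, mem_eval_fix.2 ⟨u, he, .inl ⟨h0, rfl⟩⟩⟩
        by_cases hn : I.sat nonempty o1
        · obtain ⟨t, ht, -⟩ := hn
          -- This equation is guarded: only the last iteration copies the tail of the first result
          -- to the output.
          obtain rfl : o = t := path_eq (e := (.conj (label (.fix f))
            (.neg (dia fst (dia out positive))), [out], [fst, out, tail])) hb hdef (by simp [eqs])
            ⟨hlab, hpos⟩ ⟨o, ho, rfl⟩ ⟨s, hs, o1, ho1, t, ht, rfl⟩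
          exact hu.tail_of_edge hf ht
        · obtain rfl := hu.eq_nil hn
          rcases hcase with ⟨s3, hs3, o3, ho3, hn'⟩ | ⟨o', ho', hn'⟩
          · obtain rfl := edge_unique hf (by decide) hs hs3
            obtain rfl := edge_unique hf (by decide) ho1 ho3
            exact (hn hn').elim
          · obtain rfl := edge_unique hf (by decide) ho ho'
            exact .of_not_nonempty hn'

end

end EvalGraph

namespace EvalGraph

open Turing.ToPartrec (Code)
open Separability.Concept

/-! ### The root concept of an input -/

/-- being the number `n` -/
def isNum : ℕ → Concept
  | 0 => isZero
  | n + 1 => dia pred (isNum n)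

/-- having the input `[n]` -/
def hasInput (n : ℕ) : Concept :=
  dia inp (.conj (dia tail (.neg nonempty)) (dia head (isNum n)))

/-- being an evaluation of `c` on `[n]` -/
def root (c : Code) (n : ℕ) : Concept := .conj (label c) (hasInput n)

theorem root_plain (c : Code) (n : ℕ) : (root c n).Plain (bound c) 7 := by
  have h1 : num c < bound c := num_lt_bound (self_mem_subs c)
  have h2 : 0 < bound c := Nat.succ_pos _
  have h3 : (isNum n).Plain (bound c) 7 := by
    induction n with
    | zero => simp [isNum, isZero, Plain, dia, top, h2, pred]
    | succ n ih => simp [isNum, Plain, dia, ih, pred]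
  simp [root, hasInput, Plain, dia, label, top, nonempty, h1, h2, h3, inp, tail, head]

theorem Num.of_sat {V : Type} {I : Interp V} {n : ℕ} {x : V} (h : I.sat (isNum n) x) :
    Num I x n := by
  induction n generalizing x with
  | zero => exact .of_isZero h
  | succ n ih =>
    obtain ⟨y, hy, h⟩ := h
    exact .succ x y n hy (ih h)

/-- The root concept fixes the input to `[n]`, so by `sound` the output of a good root represents a
value of `c` on `[n]`. -/
theorem dom_of_good {V : Type} {I : Interp V} {c : Code} {n : ℕ} {x : V}
    (hf : (spec c).Functional I) (hx : (spec c).Good I x) (hr : I.sat (root c n) x) :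
    (c.eval [n]).Dom := by
  obtain ⟨hlab, i, hi, ⟨t, ht, htn⟩, h, hh, hn⟩ := hr
  obtain ⟨i', o, hi', -, h1⟩ := sound hf hx c (self_mem_subs c) hlab
  obtain rfl := edge_unique hf (by decide) hi hi'
  obtain ⟨w, -, hw⟩ := h1 [n] (.cons i h t n [] hh (.of_sat hn) ht (.of_not_nonempty htn))
  exact Part.dom_iff_mem.2 ⟨w, hw⟩

/-! ### Completeness -/

/-- Numbers, lists and evaluations. -/
abbrev Node := ℕ ⊕ List ℕ ⊕ (Code × List ℕ)

/-- A number as a node. -/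
abbrev ofNum (n : ℕ) : Node := .inl n
/-- A list as a node. -/
abbrev ofList (v : List ℕ) : Node := .inr (.inl v)
/-- The evaluation of a code on an input as a node. -/
abbrev ofEval (c : Code) (v : List ℕ) : Node := .inr (.inr (c, v))

/-- The edges of the graph of all evaluations. -/
inductive Edge : ℕ → Node → Node → Prop
  | pred (n) : Edge pred (ofNum (n + 1)) (ofNum n)
  | head (n v) : Edge head (ofList (n :: v)) (ofNum n)
  | tail (n v) : Edge tail (ofList (n :: v)) (ofList v)
  | inp (c v) : Edge inp (ofEval c v) (ofList v)
  | out (c v w) (h : w ∈ c.eval v) : Edge out (ofEval c v) (ofList w)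
  | cons_fst (f g v) : Edge fst (ofEval (.cons f g) v) (ofEval f v)
  | cons_snd (f g v) : Edge snd (ofEval (.cons f g) v) (ofEval g v)
  | comp_fst (f g v) : Edge fst (ofEval (.comp f g) v) (ofEval g v)
  | comp_snd (f g v u) (h : u ∈ g.eval v) : Edge snd (ofEval (.comp f g) v) (ofEval f u)
  | case_fst (f g v) (h : v.headI = 0) : Edge fst (ofEval (.case f g) v) (ofEval f v.tail)
  | case_snd (f g v n) (h : v.headI = n + 1) :
      Edge snd (ofEval (.case f g) v) (ofEval g (n :: v.tail))
  | fix_fst (f v) : Edge fst (ofEval (.fix f) v) (ofEval f v)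
  | fix_snd (f v u) (hu : u ∈ f.eval v) (h : u.headI ≠ 0) :
      Edge snd (ofEval (.fix f) v) (ofEval (.fix f) u.tail)

/-- The graph of all evaluations. -/
def evalInterp : Interp Node where
  lab A x := ∃ c v, x = ofEval c v ∧ A = num c
  edge := Edge
  nom _ := ofNum 0

theorem edge_functional {r : ℕ} {x y z : Node} (h : Edge r x y) (h' : Edge r x z) : y = z := by
  cases h <;> cases h' <;> try rfl
  -- The remaining cases are `out`, `comp_snd`, `case_snd` and `fix_snd`, whose targets depend on a
  -- value or a predecessor that has to be shown unique.
  · rename_i h1 _ h2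
    rw [Part.mem_unique h1 h2]
  · rename_i h1 _ h2
    rw [Part.mem_unique h1 h2]
  · rename_i h1 _ h2
    rw [Nat.succ_injective (h1.symm.trans h2)]
  · rename_i h1 _ _ _ h2
    rw [Part.mem_unique h1 h2]

theorem sat_label {c : Code} {x : Node} :
    evalInterp.sat (label c) x ↔ ∃ v, x = ofEval c v := by
  constructor
  · rintro ⟨d, v, rfl, h⟩
    exact ⟨v, by rw [num_injective h]⟩
  · rintro ⟨v, rfl⟩
    exact ⟨c, v, rfl, rfl⟩

theorem sat_isZero {n : ℕ} : evalInterp.sat isZero (ofNum n) ↔ n = 0 := by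
  constructor
  · intro h
    cases n with
    | zero => rfl
    | succ n => exact (h ⟨_, .pred n, by simp⟩).elim
  · rintro rfl ⟨_, h, -⟩
    cases h

theorem sat_nonempty {v : List ℕ} : evalInterp.sat nonempty (ofList v) ↔ v ≠ [] := by
  constructor
  · rintro ⟨_, h, -⟩
    cases h
    simp
  · cases v with
    | nil => simp
    | cons n v => exact fun _ => ⟨_, .tail n v, by simp⟩

theorem sat_positive {v : List ℕ} : evalInterp.sat positive (ofList v) ↔ v.headI ≠ 0 := by
  constructor
  · rintro ⟨-, _, h, _, h', -⟩
    cases h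
    cases h'
    simp
  · intro h
    match v with
    | [] => exact (h rfl).elim
    | 0 :: v => exact (h rfl).elim
    | (n + 1) :: v => exact ⟨⟨_, .tail _ v, by simp⟩, _, .head _ v, _, .pred n, by simp⟩

/-- Termination of `c` on `v` supplies the output and the intermediate values that the required
edges point to; a diverging evaluation would lack its `out` edge. -/
theorem sat_req {c : Code} {v w : List ℕ} (hw : w ∈ c.eval v) :
    evalInterp.sat (req c) (ofEval c v) := by
  have hi : evalInterp.sat (dia inp top) (ofEval c v) := ⟨_, .inp c v, by simp⟩
  have ho : evalInterp.sat (dia out top) (ofEval c v) := ⟨_, .out c v w hw, by simp⟩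
  cases c with
  | zero' =>
    obtain rfl : w = 0 :: v := by simpa using hw
    exact ⟨hi, _, .out _ _ _ hw, sat_nonempty.2 (by simp), _, .head _ _, sat_isZero.2 rfl⟩
  | succ =>
    obtain rfl : w = [v.headI + 1] := by simpa using hw
    refine ⟨hi, ⟨_, .out _ _ _ hw, ⟨_, .tail _ _, by simp [sat_nonempty]⟩, _, .head _ _, _,
      .pred _, by simp⟩, ?_⟩
    rw [Interp.sat_disj]
    cases v with
    | cons n v => exact .inl ⟨_, .inp _ _, sat_nonempty.2 (by simp)⟩
    | nil => exact .inr ⟨_, .out _ _ _ hw, _, .head _ _, _, .pred _, sat_isZero.2 rfl⟩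
  | tail =>
    obtain rfl : w = v.tail := by simpa using hw
    refine ⟨hi, ho, ?_⟩
    rw [Interp.sat_disj]
    cases v with
    | cons n v => exact .inl ⟨_, .inp _ _, sat_nonempty.2 (by simp)⟩
    | nil => exact .inr ⟨_, .out _ _ _ hw, by simp [sat_nonempty]⟩
  | cons f g =>
    obtain ⟨a, ha, b, hb, rfl⟩ := mem_eval_cons.1 hw
    refine ⟨hi, ⟨_, .out _ _ _ hw, sat_nonempty.2 (by simp), _, .head _ _, by simp⟩,
      ⟨_, .cons_fst _ _ _, sat_label.2 ⟨_, rfl⟩⟩, ⟨_, .cons_snd _ _ _, sat_label.2 ⟨_, rfl⟩⟩, ?_⟩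
    rw [Interp.sat_disj]
    cases a with
    | cons n a =>
      exact .inl ⟨_, .cons_fst _ _ _, _, .out _ _ _ ha, sat_nonempty.2 (by simp)⟩
    | nil => exact .inr ⟨_, .out _ _ _ hw, _, .head _ _, sat_isZero.2 rfl⟩
  | comp f g =>
    obtain ⟨u, hu, -⟩ := mem_eval_comp.1 hw
    exact ⟨hi, ho, ⟨_, .comp_fst _ _ _, sat_label.2 ⟨_, rfl⟩⟩, _, .comp_snd _ _ _ _ hu,
      sat_label.2 ⟨_, rfl⟩⟩
  | case f g =>
    refine ⟨hi, ho, ?_⟩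
    rw [Interp.sat_disj]
    rcases hv : v.headI with _ | n
    · refine .inr ⟨?_, ⟨_, .case_fst _ _ _ hv, sat_label.2 ⟨_, rfl⟩⟩, ?_⟩
      · rintro ⟨_, h, h'⟩
        cases h
        exact sat_positive.1 h' hv
      · rw [Interp.sat_disj]
        cases v with
        | cons n v => exact .inl ⟨_, .inp _ _, sat_nonempty.2 (by simp)⟩
        | nil => exact .inr ⟨_, .case_fst _ _ _ hv, _, .inp _ _, by simp [sat_nonempty]⟩
    · exact .inl ⟨⟨_, .inp _ _, sat_positive.2 (by omega)⟩, _, .case_snd _ _ _ _ hv,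
        sat_label.2 ⟨_, rfl⟩, _, .inp _ _, sat_nonempty.2 (by simp), _, .head _ _, by simp⟩
  | fix f =>
    obtain ⟨u, hu, h⟩ := mem_eval_fix.1 hw
    refine ⟨hi, ho, ⟨_, .fix_fst _ _, sat_label.2 ⟨_, rfl⟩⟩, ?_⟩
    rw [Interp.sat_disj]
    rcases h with ⟨h0, rfl⟩ | ⟨h0, -⟩
    · refine .inr ⟨?_, ?_⟩
      · rintro ⟨_, h, _, h', h''⟩
        cases h
        cases h' with
        | out _ _ _ h' =>
          rw [Part.mem_unique h' hu] at h''
          exact sat_positive.1 h'' h0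
      · rw [Interp.sat_disj]
        cases u with
        | cons n u => exact .inl ⟨_, .fix_fst _ _, _, .out _ _ _ hu, sat_nonempty.2 (by simp)⟩
        | nil => exact .inr ⟨_, .out _ _ _ hw, by simp [sat_nonempty]⟩
    · exact .inl ⟨⟨_, .fix_fst _ _, _, .out _ _ _ hu, sat_positive.2 h0⟩, _,
        .fix_snd _ _ _ hu h0, sat_label.2 ⟨_, rfl⟩⟩

theorem eqs_hold {c : Code} {v w : List ℕ} (hw : w ∈ c.eval v)
    {e : Concept × List ℕ × List ℕ} (he : e ∈ eqs c) (hsat : evalInterp.sat e.1 (ofEval c v))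
    {y z : Node} (hy : evalInterp.path e.2.1 (ofEval c v) y)
    (hz : evalInterp.path e.2.2 (ofEval c v) z) : y = z := by
  cases c with
  | zero' =>
    obtain rfl := List.mem_singleton.1 he
    obtain ⟨_, h1, _, h, rfl⟩ := hy
    obtain ⟨_, ⟨⟩, rfl⟩ := hz
    obtain rfl : w = 0 :: v := by simpa using hw
    obtain rfl := edge_functional h1 (.out _ _ _ hw)
    cases h
    rfl
  | succ =>
    obtain rfl := List.mem_singleton.1 he
    obtain ⟨_, h1, _, h, _, h', rfl⟩ := hy
    obtain ⟨_, ⟨⟩, _, h'', rfl⟩ := hz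
    obtain rfl : w = [v.headI + 1] := by simpa using hw
    obtain rfl := edge_functional h1 (.out _ _ _ hw)
    cases h
    cases h'
    cases h''
    rfl
  | tail =>
    obtain rfl := List.mem_singleton.1 he
    obtain ⟨_, h1, rfl⟩ := hy
    obtain ⟨_, ⟨⟩, _, h, rfl⟩ := hz
    obtain rfl : w = v.tail := by simpa using hw
    obtain rfl := edge_functional h1 (.out _ _ _ hw)
    cases h
    rfl
  | cons f g =>
    obtain ⟨a, ha, b, hb, rfl⟩ := mem_eval_cons.1 hw
    simp only [eqs, List.mem_cons, List.not_mem_nil, or_false] at he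
    rcases he with rfl | rfl | rfl | rfl
    · obtain ⟨_, ⟨⟩, _, ⟨⟩, rfl⟩ := hy
      obtain ⟨_, ⟨⟩, rfl⟩ := hz
      rfl
    · obtain ⟨_, ⟨⟩, _, ⟨⟩, rfl⟩ := hy
      obtain ⟨_, ⟨⟩, rfl⟩ := hz
      rfl
    · obtain ⟨_, h1, _, h2, rfl⟩ := hy
      obtain ⟨_, ⟨⟩, _, h3, rfl⟩ := hz
      obtain rfl := edge_functional h1 (.out _ _ _ hw)
      obtain rfl := edge_functional h2 (.tail _ _)
      exact edge_functional (.out _ _ _ hb) h3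
    · obtain ⟨_, h1, _, h2, rfl⟩ := hy
      obtain ⟨_, ⟨⟩, _, h3, _, h4, rfl⟩ := hz
      obtain rfl := edge_functional h1 (.out _ _ _ hw)
      obtain rfl := edge_functional h2 (.head _ _)
      obtain rfl := edge_functional h3 (.out _ _ _ ha)
      cases h4
      rfl
  | comp f g =>
    obtain ⟨u, hu, hwu⟩ := mem_eval_comp.1 hw
    simp only [eqs, List.mem_cons, List.not_mem_nil, or_false] at he
    rcases he with rfl | rfl | rfl
    · obtain ⟨_, ⟨⟩, _, ⟨⟩, rfl⟩ := hy
      obtain ⟨_, ⟨⟩, rfl⟩ := hz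
      rfl
    · obtain ⟨_, h1, _, ⟨⟩, rfl⟩ := hy
      obtain ⟨_, ⟨⟩, _, h2, rfl⟩ := hz
      obtain h3 := edge_functional h1 (.comp_snd _ _ _ _ hu)
      cases h3
      exact edge_functional (.out _ _ _ hu) h2
    · obtain ⟨_, h1, rfl⟩ := hy
      obtain ⟨_, h2, _, h3, rfl⟩ := hz
      obtain rfl := edge_functional h1 (.out _ _ _ hw)
      obtain rfl := edge_functional h2 (.comp_snd _ _ _ _ hu)
      exact edge_functional (.out _ _ _ hwu) h3
  | case f g =>
    simp only [eqs, List.mem_cons, List.not_mem_nil, or_false] at he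
    rcases he with rfl | rfl | rfl | rfl | rfl
    · obtain ⟨_, ⟨⟩, _, ⟨⟩, rfl⟩ := hy
      obtain ⟨_, ⟨⟩, _, ⟨⟩, rfl⟩ := hz
      rfl
    · obtain ⟨_, h1, _, h2, _, h3, rfl⟩ := hy
      obtain ⟨_, ⟨⟩, _, ⟨⟩, _, ⟨⟩, rfl⟩ := hz
      obtain rfl := edge_functional h1 (.case_snd _ _ _ _ rfl)
      cases h2
      cases h3
      rfl
    · obtain ⟨_, ⟨⟩, _, h2, _, h3, rfl⟩ := hy
      obtain ⟨_, ⟨⟩, _, ⟨⟩, rfl⟩ := hz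
      cases h2
      cases h3
      rfl
    · obtain ⟨_, h1, rfl⟩ := hy
      obtain ⟨_, h2, _, h3, rfl⟩ := hz
      cases h2 with
      | case_fst _ _ _ h0 =>
        obtain rfl := edge_functional h1 (.out _ _ _ hw)
        exact edge_functional (.out _ _ _ ((mem_eval_case_zero h0).1 hw)) h3
    · obtain ⟨_, h1, rfl⟩ := hy
      obtain ⟨_, h2, _, h3, rfl⟩ := hz
      cases h2 with
      | case_snd _ _ _ _ h0 =>
        obtain rfl := edge_functional h1 (.out _ _ _ hw)
        exact edge_functional (.out _ _ _ ((mem_eval_case_succ h0).1 hw)) h3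
  | fix f =>
    obtain ⟨u, hu, h⟩ := mem_eval_fix.1 hw
    simp only [eqs, List.mem_cons, List.not_mem_nil, or_false] at he
    rcases he with rfl | rfl | rfl | rfl
    · obtain ⟨_, ⟨⟩, _, ⟨⟩, rfl⟩ := hy
      obtain ⟨_, ⟨⟩, rfl⟩ := hz
      rfl
    · obtain ⟨_, h1, _, h2, rfl⟩ := hy
      obtain ⟨_, ⟨⟩, _, h3, _, h4, rfl⟩ := hz
      obtain rfl := edge_functional h3 (.out _ _ _ hu)
      cases h1 with
      | fix_snd _ _ u' hu' h0 =>
        obtain rfl := Part.mem_unique hu hu'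
        cases h2
        cases h4
        rfl
    · obtain ⟨_, h1, rfl⟩ := hy
      obtain ⟨_, h2, _, h3, rfl⟩ := hz
      obtain rfl := edge_functional h1 (.out _ _ _ hw)
      cases h2 with
      | fix_snd _ _ u' hu' h0 =>
        obtain rfl := Part.mem_unique hu hu'
        rcases h with ⟨h0', -⟩ | ⟨-, h⟩
        · exact (h0 h0').elim
        · exact edge_functional (.out _ _ _ h) h3
    · obtain ⟨_, h1, rfl⟩ := hy
      obtain ⟨_, ⟨⟩, _, h3, _, h4, rfl⟩ := hz
      obtain rfl := edge_functional h1 (.out _ _ _ hw)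
      obtain rfl := edge_functional h3 (.out _ _ _ hu)
      rcases h with ⟨-, rfl⟩ | ⟨h0, -⟩
      · cases h4
        rfl
      -- A positive head contradicts the guard of the last equation.
      · exact (hsat.2 ⟨_, .fix_fst _ _, _, .out _ _ _ hu, sat_positive.2 h0⟩).elim

theorem sat_eqs_fst {c : Code} {e : Concept × List ℕ × List ℕ} (he : e ∈ eqs c) {x : Node}
    (h : evalInterp.sat e.1 x) : ∃ v, x = ofEval c v := by
  rcases eqs_fst he with h' | h' <;> rw [h'] at h
  · exact sat_label.1 h
  · exact sat_label.1 h.1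

variable {c : Code}

theorem good_of_not_eval {x : Node} (hx : ∀ b v, x ≠ ofEval b v)
    (h : ∀ r y, Edge r x y → (spec c).Good evalInterp y) : (spec c).Good evalInterp x := by
  refine .mk x ?_ ?_ fun r _ y hy => h r y hy
  · intro C hC
    obtain ⟨d, -, rfl⟩ := List.mem_map.1 hC
    rintro ⟨h1, -⟩
    exact hx _ _ h1.choose_spec.choose_spec.1
  · rintro ⟨e, he, h1, -⟩
    obtain ⟨b, -, he⟩ := List.mem_flatMap.1 he
    obtain ⟨v, rfl⟩ := sat_eqs_fst he h1
    exact hx _ _ rfl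

theorem good_ofNum (n : ℕ) : (spec c).Good evalInterp (ofNum n) := by
  induction n with
  | zero => exact good_of_not_eval (by simp) (by rintro r y ⟨⟩)
  | succ n ih => exact good_of_not_eval (by simp) (by rintro r y ⟨⟩; exact ih)

theorem good_ofList (v : List ℕ) : (spec c).Good evalInterp (ofList v) := by
  induction v with
  | nil => exact good_of_not_eval (by simp) (by rintro r y ⟨⟩)
  | cons n v ih =>
    refine good_of_not_eval (by simp) ?_
    rintro r y ⟨⟩
    · exact good_ofNum _
    · exact ih

/-- A terminating evaluation has no defect of its own, and its input and output are lists, which are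
good; only the subevaluations remain. -/
theorem good_of_subevals {b : Code} {v w : List ℕ} (hw : w ∈ b.eval v)
    (h : ∀ r y, Edge r (ofEval b v) y → r = fst ∨ r = snd → (spec c).Good evalInterp y) :
    (spec c).Good evalInterp (ofEval b v) := by
  refine .mk _ ?_ ?_ ?_
  · intro C hC
    obtain ⟨d, -, rfl⟩ := List.mem_map.1 hC
    rintro ⟨h1, h2⟩
    obtain ⟨_, h3⟩ := sat_label.1 h1
    cases h3
    exact h2 (sat_req hw)
  · rintro ⟨e, he, h1, y, z, hy, hz, hne⟩
    obtain ⟨d, -, he⟩ := List.mem_flatMap.1 he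
    obtain ⟨_, h3⟩ := sat_eqs_fst he h1
    cases h3
    exact hne (eqs_hold hw he h1 hy hz)
  · intro r hr y hy
    by_cases h5 : r = fst ∨ r = snd
    · exact h r y hy h5
    · cases hy <;> first
        | exact good_ofList _
        | simp at h5

/-- Induction on the code, since a terminating evaluation calls only terminating ones. -/
theorem good_ofEval {b : Code} {v w : List ℕ} (hw : w ∈ b.eval v) :
    (spec c).Good evalInterp (ofEval b v) := by
  induction b generalizing v w with
  | zero' => exact good_of_subevals hw (by rintro r y ⟨⟩ h <;> simp at h)
  | succ => exact good_of_subevals hw (by rintro r y ⟨⟩ h <;> simp at h)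
  | tail => exact good_of_subevals hw (by rintro r y ⟨⟩ h <;> simp at h)
  | cons f g ihf ihg =>
    obtain ⟨a, ha, b, hb, rfl⟩ := mem_eval_cons.1 hw
    refine good_of_subevals hw ?_
    rintro r y ⟨⟩ h
    · simp at h
    · simp at h
    · exact ihf ha
    · exact ihg hb
  | comp f g ihf ihg =>
    obtain ⟨u, hu, hwu⟩ := mem_eval_comp.1 hw
    refine good_of_subevals hw ?_
    rintro r y hy h
    cases hy with
    | inp => simp at h
    | out => simp at h
    | comp_fst => exact ihg hu
    | comp_snd _ _ _ u' hu' =>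
      obtain rfl := Part.mem_unique hu hu'
      exact ihf hwu
  | case f g ihf ihg =>
    refine good_of_subevals hw ?_
    rintro r y hy h
    cases hy with
    | inp => simp at h
    | out => simp at h
    | case_fst _ _ _ h0 => exact ihf ((mem_eval_case_zero h0).1 hw)
    | case_snd _ _ _ _ h0 => exact ihg ((mem_eval_case_succ h0).1 hw)
  | fix f ih =>
    rw [Turing.ToPartrec.Code.fix_eval] at hw
    -- The loop calls itself with the same code, so a second induction runs over its terminating
    -- iterations.
    refine PFun.fixInduction (C := fun v => (spec c).Good evalInterp (ofEval (.fix f) v)) hw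
      fun v hv ihv => ?_
    replace hv : w ∈ (Code.fix f).eval v := by
      rw [Turing.ToPartrec.Code.fix_eval]
      exact hv
    obtain ⟨u, hu, -⟩ := mem_eval_fix.1 hv
    refine good_of_subevals hv ?_
    rintro r y hy h
    cases hy with
    | inp => simp at h
    | out => simp at h
    | fix_fst => exact ih hu
    | fix_snd _ _ u' hu' h0 =>
      refine ihv _ (Part.mem_map_iff _ |>.2 ⟨u', hu', ?_⟩)
      rw [if_neg h0]

theorem exists_good_of_dom {n : ℕ} (h : (c.eval [n]).Dom) :
    ∃ x, (spec c).Good evalInterp x ∧ evalInterp.sat (root c n) x := by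
  refine ⟨ofEval c [n], good_ofEval (Part.get_mem h), sat_label.2 ⟨_, rfl⟩, _, .inp _ _,
    ⟨_, .tail _ _, by simp [sat_nonempty]⟩, _, .head _ _, ?_⟩
  clear h
  induction n with
  | zero => exact sat_isZero.2 rfl
  | succ n ih => exact ⟨_, .pred n, ih⟩

end EvalGraph

/-! ### The reduction is computable -/

/-- The Gödel number of an implication. -/
def impCode (a b : ℕ) : ℕ := Nat.pair 2 (Nat.pair a b) + 1
/-- The Gödel number of a universal quantification. -/
def allCode (a : ℕ) : ℕ := Nat.pair 3 a + 1
/-- The Gödel number of a negation. -/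
def notCode (a : ℕ) : ℕ := impCode a 0
/-- The Gödel number of a conjunction. -/
def andCode (a b : ℕ) : ℕ := notCode (impCode a (notCode b))
/-- The Gödel number of an existential quantification. -/
def exCode (a : ℕ) : ℕ := notCode (allCode (notCode a))
/-- The Gödel number of a unary atom with a variable. -/
def labCode (A x : ℕ) : ℕ :=
  Nat.pair 1 (Nat.pair 1 (Nat.pair A (Encodable.encode [Nat.pair 0 x]))) + 1
/-- The Gödel number of a binary atom with two variables. -/
def edgeCode (r x y : ℕ) : ℕ :=
  Nat.pair 1 (Nat.pair 2 (Nat.pair r (Encodable.encode [Nat.pair 0 x, Nat.pair 0 y]))) + 1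

theorem primrec_impCode : Primrec₂ impCode :=
  Primrec.succ.comp (Primrec₂.natPair.comp (Primrec.const 2) Primrec₂.natPair)

theorem primrec_allCode : Primrec allCode :=
  Primrec.succ.comp (Primrec₂.natPair.comp (Primrec.const 3) Primrec.id)

theorem primrec_notCode : Primrec notCode :=
  primrec_impCode.comp Primrec.id (Primrec.const 0)

theorem primrec_andCode : Primrec₂ andCode :=
  primrec_notCode.comp (primrec_impCode.comp Primrec.fst (primrec_notCode.comp Primrec.snd))

theorem primrec_exCode : Primrec exCode :=
  primrec_notCode.comp (primrec_allCode.comp primrec_notCode)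

theorem primrec_labCode (A : ℕ) : Primrec (labCode A) :=
  Primrec.succ.comp (Primrec₂.natPair.comp (Primrec.const 1)
    (Primrec₂.natPair.comp (Primrec.const 1) (Primrec₂.natPair.comp (Primrec.const A)
      (Primrec.encode.comp (Primrec.list_cons.comp
        (Primrec₂.natPair.comp (Primrec.const 0) Primrec.id) (Primrec.const []))))))

theorem primrec_edgeCode (r : ℕ) : Primrec₂ (edgeCode r) :=
  Primrec.succ.comp (Primrec₂.natPair.comp (Primrec.const 1)
    (Primrec₂.natPair.comp (Primrec.const 2) (Primrec₂.natPair.comp (Primrec.const r)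
      (Primrec.encode.comp (Primrec.list_cons.comp
        (Primrec₂.natPair.comp (Primrec.const 0) Primrec.fst) (Primrec.list_cons.comp
        (Primrec₂.natPair.comp (Primrec.const 0) Primrec.snd) (Primrec.const [])))))))

theorem fmlCode_name (A : ℕ) {m : ℕ} (i : Fin m) :
    fmlCode ((Concept.name A).toFO (.inr i)) = labCode A i := by
  show Nat.pair 1 (Nat.pair 1 (Nat.pair A (Encodable.encode (List.ofFn _)))) + 1 = _
  simp [labCode, termCode]

theorem fmlCode_edge (r : ℕ) {m : ℕ} (i j : Fin m) :
    fmlCode ((Role.name r).toFO (.inr i) (.inr j)) = edgeCode r i j := by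
  show Nat.pair 1 (Nat.pair 2 (Nat.pair r (Encodable.encode (List.ofFn _)))) + 1 = _
  simp [edgeCode, termCode]

/-- Bound variables are numbered from the outside, so the variable of the new quantifier is `m` and
the older ones keep their numbers. -/
theorem fmlCode_dia (r : ℕ) (C : Concept) {m : ℕ} (i : Fin m) :
    fmlCode ((Concept.dia r C).toFO (.inr i)) = exCode (andCode (edgeCode r i m)
      (fmlCode (C.toFO (n := m + 1) (.inr (Fin.last m))))) := by
  rw [show edgeCode r i m = edgeCode r i.castSucc (Fin.last m) by simp, ← fmlCode_edge]
  rfl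

theorem fmlCode_neg (C : Concept) {m : ℕ} (i : Fin m) :
    fmlCode (C.neg.toFO (.inr i)) = notCode (fmlCode (C.toFO (.inr i))) := rfl

theorem fmlCode_conj (C D : Concept) {m : ℕ} (i : Fin m) : fmlCode ((C.conj D).toFO (.inr i)) =
    andCode (fmlCode (C.toFO (.inr i))) (fmlCode (D.toFO (.inr i))) := rfl

namespace EvalGraph

open Turing.ToPartrec (Code)
open Separability.Concept

/-- The Gödel number of `isNum n` for the variable `m`. -/
def isNumCode (n m : ℕ) : ℕ := fmlCode ((isNum n).toFO (n := m + 1) (.inr (Fin.last m)))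

theorem isNumCode_succ (n m : ℕ) : isNumCode (n + 1) m =
    exCode (andCode (edgeCode pred m (m + 1)) (isNumCode n (m + 1))) :=
  fmlCode_dia pred (isNum n) (Fin.last m)

theorem primrec_isNumCode_zero : Primrec (isNumCode 0) := by
  have h : ∀ m, isNumCode 0 m = notCode (exCode (andCode (edgeCode pred m (m + 1))
      (notCode (andCode (labCode 0 (m + 1)) (notCode (labCode 0 (m + 1))))))) := by
    intro m
    simp only [isNumCode, isNum, isZero, top, fmlCode_neg, fmlCode_dia, fmlCode_conj,
      fmlCode_name, Fin.val_last]
  have h1 : Primrec fun m => labCode 0 (m + 1) := (primrec_labCode 0).comp Primrec.succ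
  exact (primrec_notCode.comp (primrec_exCode.comp (primrec_andCode.comp
    ((primrec_edgeCode pred).comp Primrec.id Primrec.succ) (primrec_notCode.comp
      (primrec_andCode.comp h1 (primrec_notCode.comp h1)))))).of_eq fun m => (h m).symm

/-- Unfolding `isNum` raises the variable index while the number decreases, so this is no recursion
with a fixed parameter. `F n` builds the code from the inside: after `t` steps it has reached the
code of `isNum t` at depth `n + k - t`, and `t = n` gives depth `k`. -/
theorem primrec_isNumCode (k : ℕ) : Primrec fun n => isNumCode n k := by
  let F : ℕ → ℕ → ℕ := fun n t => Nat.rec (isNumCode 0 (n + k))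
    (fun t a => exCode (andCode (edgeCode pred (n + k - (t + 1)) (n + k - t)) a)) t
  have hF : ∀ n t, t ≤ n → F n t = isNumCode t (n + k - t) := by
    intro n t ht
    induction t with
    | zero => rfl
    | succ t ih =>
      rw [isNumCode_succ, show n + k - (t + 1) + 1 = n + k - t by omega, ← ih (by omega)]
  have hnk : Primrec fun p : ℕ × ℕ × ℕ => p.1 + k :=
    Primrec.nat_add.comp Primrec.fst (Primrec.const k)
  have ht : Primrec fun p : ℕ × ℕ × ℕ => p.2.1 := Primrec.fst.comp Primrec.snd
  have hFp : Primrec₂ F := by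
    refine Primrec.nat_rec (f := fun n => isNumCode 0 (n + k))
      (g := fun n p => exCode (andCode (edgeCode pred (n + k - (p.1 + 1)) (n + k - p.1)) p.2))
      (primrec_isNumCode_zero.comp (Primrec.nat_add.comp Primrec.id (Primrec.const k))) ?_
    exact primrec_exCode.comp (primrec_andCode.comp ((primrec_edgeCode pred).comp
      (Primrec.nat_sub.comp hnk (Primrec.succ.comp ht)) (Primrec.nat_sub.comp hnk ht))
      (Primrec.snd.comp Primrec.snd))
  refine (hFp.comp Primrec.id Primrec.id).of_eq fun n => ?_
  rw [id, hF n n le_rfl, Nat.add_sub_cancel_left]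

theorem primrec_rootStatement (S : DefectSpec) (c : Code) :
    Primrec fun n => fmlCode (S.rootStatement (root c n)).toFO := by
  have h : ∀ n, fmlCode (S.rootStatement (root c n)).toFO =
      allCode (impCode (andCode (labCode S.posName 0) (andCode (labCode (num c) 0)
        (exCode (andCode (edgeCode inp 0 1) (andCode
          (fmlCode ((dia tail (.neg nonempty)).toFO (n := 2) (.inr 1)))
          (exCode (andCode (edgeCode head 1 2) (isNumCode n 2))))))))
        (labCode S.traceName 0)) := by
    intro n
    have h1 : fmlCode ((Concept.conj (.name S.posName) (root c n)).toFO (n := 1) (.inr 0)) =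
        andCode (labCode S.posName 0) (andCode (labCode (num c) 0)
        (exCode (andCode (edgeCode inp 0 1) (andCode
          (fmlCode ((dia tail (.neg nonempty)).toFO (n := 2) (.inr 1)))
          (exCode (andCode (edgeCode head 1 2) (isNumCode n 2))))))) := by
      rw [fmlCode_conj, fmlCode_name, root, fmlCode_conj, label, fmlCode_name, hasInput,
        fmlCode_dia, fmlCode_conj, fmlCode_dia head]
      rfl
    rw [← h1, show labCode S.traceName 0 = _ from
      (fmlCode_name S.traceName (0 : Fin 1)).symm]
    rfl
  refine Primrec.of_eq ?_ fun n => (h n).symm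
  exact primrec_allCode.comp (primrec_impCode.comp (primrec_andCode.comp (Primrec.const _)
    (primrec_andCode.comp (Primrec.const _) (primrec_exCode.comp (primrec_andCode.comp
      (Primrec.const _) (primrec_andCode.comp (Primrec.const _) (primrec_exCode.comp
        (primrec_andCode.comp (Primrec.const _) (primrec_isNumCode 2)))))))) (Primrec.const _))

/-- There is a code with an undecidable halting problem. -/
theorem exists_undecidable_code :
    ∃ c : Code, ¬ ComputablePred fun n : ℕ => (c.eval [n]).Dom := by
  -- A universal function: `n` is read as a program and run on 0.
  have hf : Partrec fun n : ℕ => (Denumerable.ofNat Nat.Partrec.Code n).eval 0 :=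
    Nat.Partrec.Code.eval_part.comp (Computable.ofNat _) (Computable.const 0)
  obtain ⟨c, hc⟩ := Code.exists_code (Nat.Partrec'.part_iff₁.2 hf)
  refine ⟨c, fun h => ComputablePred.halting_problem 0 ?_⟩
  obtain ⟨f, hf, hfe⟩ := ComputablePred.computable_iff.1 h
  refine ComputablePred.computable_iff.2 ⟨fun d => f (Encodable.encode d),
    hf.comp Computable.encode, funext fun d => ?_⟩
  rw [← congrFun hfe (Encodable.encode d)]
  have := hc ⟨[Encodable.encode d], rfl⟩
  rw [show c.eval [Encodable.encode d] = _ from this]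
  simp [List.Vector.head]

end EvalGraph

/-! ### Assembling the reduction -/

open EvalGraph in
/-- A computable family of labeled KBs whose separability is undecidable. -/
theorem exists_reduction (L : Fragment) (hL : L.Contains ALCFIO) (c : Turing.ToPartrec.Code) :
    ∃ I : ℕ → Input, (Computable fun n => (I n).raw) ∧ ∀ n, (I n).IsLabeledKB L ∧
      ((c.eval [n]).Dom → (I n).Separable L) ∧
      ((I n).ProjectivelySeparable L → (c.eval [n]).Dom) := by
  obtain ⟨tr, htr, h⟩ := hL.2.2.1
  -- `T` is chosen without regard to computability, but the Gödel number of `T s` is `tr` of that of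
  -- `s`.
  choose! T hT1 hT2 hT3 hT4 _ using fun s : Statement => h s.toFO ⟨s, rfl⟩
  set S := spec c
  let onto : ℕ → List Voc.Sentence := fun n => (S.rootStatement (root c n) :: S.baseOnto).map T
  have hre : ∀ n, Rewrites L (onto n) (S.rootStatement (root c n) :: S.baseOnto) := by
    intro n
    refine ⟨?_, ?_, fun s hs => ⟨T s, List.mem_map_of_mem hs, hT3 s, hT4 s⟩⟩
    · intro ψ hψ
      obtain ⟨s, -, rfl⟩ := List.mem_map.1 hψ
      exact hT1 s
    · intro ψ hψ
      obtain ⟨s, hs, rfl⟩ := List.mem_map.1 hψ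
      exact ⟨s, hs, hT3 s⟩
  refine ⟨fun n => S.input (onto n), ?_, fun n => ⟨S.isLabeledKB hL (hre n), ?_, ?_⟩⟩
  -- Only the first sentence varies with `n`; the codes of the others and the remaining components
  -- of the input are constants.
  · have h1 : Computable fun n => tr (fmlCode (S.rootStatement (root c n)).toFO) ::
        S.baseOnto.map fun s => fmlCode (T s) :=
      Computable.list_cons.comp (htr.comp (primrec_rootStatement S c).to_comp)
        (Computable.const _)
    refine (h1.pair (Computable.const (S.input []).raw.2)).of_eq fun n => ?_
    refine Prod.ext ?_ rfl
    show _ = (onto n).map fmlCode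
    simp [onto, hT2]
  · intro hdom
    obtain ⟨x, hx, hr⟩ := exists_good_of_dom hdom
    -- Any numbering of the nodes by constants will do, as the separating formula need not be
    -- computed.
    have : Encodable Node := Encodable.ofCountable _
    exact S.separable_of_good hL (hre n) (num_lt_bound (self_mem_subs c)) (root_plain c n).2
      (spec_eqs_lt c) (fun r _ x y z h h' => edge_functional h h') hx hr
  · intro hsep
    obtain ⟨V, I, x, hI, hx, hr⟩ := S.projectivelySeparable_imp (hre n) (root_plain c n) hsep
    exact dom_of_good hI hx hr

theorem Input.Separable.projectivelySeparable {L : Fragment} {I : Input} (h : I.Separable L) :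
    I.ProjectivelySeparable L := by
  obtain ⟨φ, h1, h2, -⟩ := h
  exact ⟨φ, h1, h2⟩

/-- On the instances of the reduction, separability with and without helper symbols coincide with
halting, and so does every property between them. -/
theorem undecidable_of_between (L : Fragment) (hL : L.Contains ALCFIO) (Q : Input → Prop)
    (h1 : ∀ I : Input, I.Separable L → Q I) (h2 : ∀ I : Input, Q I → I.ProjectivelySeparable L) :
    Undecidable (Input.IsLabeledKB L) Q := by
  rintro ⟨f, hf, hQ⟩
  obtain ⟨c, hc⟩ := EvalGraph.exists_undecidable_code
  obtain ⟨I, hI, hred⟩ := exists_reduction L hL c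
  refine hc (ComputablePred.computable_iff.2 ⟨fun n => f (I n).raw, hf.comp hI, funext fun n => ?_⟩)
  obtain ⟨h3, h4, h5⟩ := hred n
  refine propext (Iff.trans ?_ (hQ (I n) h3).symm)
  exact ⟨fun h => h1 _ (h4 h), fun h => h5 (h2 _ h)⟩

end Separability

theorem mainTheorem5 (L : Separability.Fragment) (hL : L.Contains Separability.ALCFIO) :
    Separability.Undecidable (Separability.Input.IsLabeledKB L)
        (Separability.Input.ProjectivelySeparable L) ∧
      Separability.Undecidable (Separability.Input.IsLabeledKB L)
        (Separability.Input.Separable L) := by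
  exact ⟨Separability.undecidable_of_between L hL _ (fun _ h => h.projectivelySeparable)
    fun _ h => h, Separability.undecidable_of_between L hL _ (fun _ h => h)
    fun _ h => h.projectivelySeparable⟩
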